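/- A Dyck path of semilength $n$ is a lattice path from $(0,0)$ to $(2n,0)$ with up-steps $U=(1,1)$ and down-steps $D=(1,-1)$ that never goes below the $x$-axis; let $\mathcal D_n$ be the set of these paths. For $P,P'\in\mathcal D_n$ write $P\to P'$ if $P'$ is obtained from $P$ by replacing one occurrence of $DU^kD^k$, for some $k\ge 1$, by $U^kD^kD$. Let $\le$ be the reflexive transitive closure of $\to$, and let $\mathcal S_n=(\mathcal D_n,\le)$. An interval of $\mathcal S_n$ is here a pair $(P,Q)\in\mathcal D_n\times\mathcal D_n$ with $P\le Q$; $Q$ is called its upper path. A nonempty Dyck path is prime if it touches the $x$-axis only at its beginning and its end. For $n,k\ge 1$ let $a_{n,k}$ be the number of intervals of $\mathcal S_n$ whose upper path ends with exactly $k$ down-steps, and let $b_{n,k}$ be the number of those intervals for which, in addition, the upper path is prime. Put $$I(x,y)=\sum_{n,k\ge1}a_{n,k}x^ny^k,\qquad J(x,y)=\sum_{n,k\ge1}b_{n,k}x^ny^k ,$$ which are power series in $x$ whose coefficients are polynomials in $y$, and let $\sqrt{1-8x}$ be the formal power series with constant term $1$ whose square is $1-8x$. Theorem. The generating function $I(x,y)$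 for the intervals of the posets $\mathcal S_n$, with respect to the semilength and the size of the last run of down-steps of the upper path, satisfies $$I(x,y)=J(x,y)\cdot\frac{3-\sqrt{1-8x}}{2(x+1)},$$ and the generating function $I(x,1)=\sum_{n\ge1}\#\{\text{intervals of }\mathcal S_n\}\,x^n$ for the intervals with respect to the semilength is $$I(x,1)=\frac{1-2x-\sqrt{1-8x}}{2(x+1)}.$$ -/

import Mathlib

/-- Dyck paths of semilength `n` (the set `𝒟ₙ`). -/
abbrev DyckPath (n : ℕ) : Type := {p : DyckWord // p.semilength = n}

namespace DyckPath

/-- The elementary move `P ⟶ P'`: some occurrence of `D U^k D^k` in `P`, with `k ≥ 1`, is replaced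
by `U^k D^k D`. -/
def Move {n : ℕ} (P P' : DyckPath n) : Prop :=
  ∃ (k : ℕ) (A B : List DyckStep), 1 ≤ k ∧
    P.1.toList =
      A ++ (DyckStep.D :: (List.replicate k DyckStep.U ++ List.replicate k DyckStep.D)) ++ B ∧
    P'.1.toList =
      A ++ (List.replicate k DyckStep.U ++ List.replicate k DyckStep.D ++ [DyckStep.D]) ++ B

/-- The order of the poset `𝒮ₙ` on `𝒟ₙ`: the reflexive transitive closure of `Move`.
(This is not the order that `DyckWord` carries in the library.) -/
def Below {n : ℕ} (P Q : DyckPath n) : Prop :=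
  Relation.ReflTransGen Move P Q

/-- The number of down-steps in the last run of down-steps, i.e. the number of down-steps with
which the path ends. -/
def lastDownRun {n : ℕ} (Q : DyckPath n) : ℕ :=
  (Q.1.toList.reverse.takeWhile (fun s => decide (s = DyckStep.D))).length

/-- The path is nonempty and touches the `x`-axis only at its beginning and at its end:
after `i` steps, with `i` neither `0` nor the full length, it is strictly above the axis. -/
def IsPrime {n : ℕ} (Q : DyckPath n) : Prop :=
  0 < n ∧ ∀ i : ℕ, 0 < i → i < Q.1.toList.length →
    (Q.1.toList.take i).count DyckStep.D < (Q.1.toList.take i).count DyckStep.U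

/-- The last run of down-steps has size at most `n`. -/
theorem lastDownRun_le {n : ℕ} (Q : DyckPath n) : Q.lastDownRun ≤ n := by
  set l := Q.1.toList.reverse.takeWhile (fun s => decide (s = DyckStep.D)) with hl
  have h1 : l.count DyckStep.D = l.length := by
    rw [List.count_eq_length]
    intro b hb
    have := List.mem_takeWhile_imp hb
    simpa [eq_comm] using this
  have h2 : l.count DyckStep.D ≤ Q.1.toList.reverse.count DyckStep.D :=
    (List.takeWhile_sublist _).count_le _
  rw [List.count_reverse, ← DyckWord.semilength_eq_count_D, Q.2, h1] at h2
  exact h2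

end DyckPath

/-- The number `a_{n,k}` of intervals of `𝒮ₙ`, i.e. of pairs `(P, Q)` with `P ≤ Q`, whose upper
path `Q` ends with exactly `k` down-steps. -/
noncomputable def intervalCount (n k : ℕ) : ℕ :=
  {I : DyckPath n × DyckPath n | I.1.Below I.2 ∧ I.2.lastDownRun = k}.ncard

/-- The number `b_{n,k}` of intervals `(P, Q)` of `𝒮ₙ` whose upper path `Q` is prime and ends with
exactly `k` down-steps. -/
noncomputable def primeIntervalCount (n k : ℕ) : ℕ :=
  {I : DyckPath n × DyckPath n |
    I.1.Below I.2 ∧ I.2.IsPrime ∧ I.2.lastDownRun = k}.ncard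

/-- The number of all intervals of `𝒮ₙ`. -/
noncomputable def totalIntervalCount (n : ℕ) : ℕ :=
  {I : DyckPath n × DyckPath n | I.1.Below I.2}.ncard

/-- There are no intervals with `k > n`; so the sums over `1 ≤ k ≤ n` below run over all `k ≥ 1`. -/
theorem intervalCount_eq_zero {n k : ℕ} (h : n < k) : intervalCount n k = 0 := by
  have : {I : DyckPath n × DyckPath n | I.1.Below I.2 ∧ I.2.lastDownRun = k} = ∅ := by
    ext I
    have := I.2.lastDownRun_le
    simp only [Set.mem_ofPred_eq, Set.mem_empty_iff_false, iff_false]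
    omega
  rw [intervalCount, this, Set.ncard_empty]

/-- There are no intervals with prime upper path and `k > n`. -/
theorem primeIntervalCount_eq_zero {n k : ℕ} (h : n < k) : primeIntervalCount n k = 0 := by
  have : {I : DyckPath n × DyckPath n |
      I.1.Below I.2 ∧ I.2.IsPrime ∧ I.2.lastDownRun = k} = ∅ := by
    ext I
    have := I.2.lastDownRun_le
    simp only [Set.mem_ofPred_eq, Set.mem_empty_iff_false, iff_false]
    omega
  rw [primeIntervalCount, this, Set.ncard_empty]

/-- `I(x,y) = ∑_{n,k ≥ 1} a_{n,k} xⁿ yᵏ`, as a power series in `x` whose coefficients are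
polynomials in `y` (the polynomial variable). The coefficient of `x⁰` is an empty sum. -/
noncomputable def intervalGF : PowerSeries (Polynomial ℚ) :=
  PowerSeries.mk fun n =>
    ∑ k ∈ Finset.Icc 1 n, Polynomial.monomial k (intervalCount n k : ℚ)

/-- `J(x,y) = ∑_{n,k ≥ 1} b_{n,k} xⁿ yᵏ`. -/
noncomputable def primeIntervalGF : PowerSeries (Polynomial ℚ) :=
  PowerSeries.mk fun n =>
    ∑ k ∈ Finset.Icc 1 n, Polynomial.monomial k (primeIntervalCount n k : ℚ)

/-- The substitution `y = 1`, coefficientwise. -/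
noncomputable def setYOne : PowerSeries (Polynomial ℚ) →+* PowerSeries ℚ :=
  PowerSeries.map (Polynomial.evalRingHom 1)

/-- A power series in `x` alone, regarded as a series in `x` and `y`. -/
noncomputable def constInY : PowerSeries ℚ →+* PowerSeries (Polynomial ℚ) :=
  PowerSeries.map Polynomial.C

/-- The formal power series `√(1 - 8x) = ∑ₙ (1/2 choose n) (-8)ⁿ xⁿ`. -/
noncomputable def sqrtOneSubEightX : PowerSeries ℚ :=
  PowerSeries.mk fun n => Ring.choose (1 / 2 : ℚ) n * (-8) ^ n

/-- It is the square root of `1 - 8x` with constant term `1`. -/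
theorem sqrtOneSubEightX_spec :
    sqrtOneSubEightX ^ 2 = 1 - 8 * PowerSeries.X ∧
      PowerSeries.constantCoeff sqrtOneSubEightX = 1 := by
  have h : sqrtOneSubEightX =
      PowerSeries.rescale (-8 : ℚ) (PowerSeries.binomialSeries ℚ (1 / 2 : ℚ)) := by
    ext n
    simp [sqrtOneSubEightX, PowerSeries.coeff_rescale, mul_comm]
  constructor
  · rw [h, ← map_pow, sq, ← PowerSeries.binomialSeries_add]
    have : (1 / 2 + 1 / 2 : ℚ) = ((1 : ℕ) : ℚ) := by norm_num
    rw [this, PowerSeries.binomialSeries_nat]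
    have h8 : (8 : PowerSeries ℚ) = PowerSeries.C (8 : ℚ) := (map_ofNat PowerSeries.C 8).symm
    simp [PowerSeries.rescale_X, h8, sub_eq_add_neg]
  · simp [sqrtOneSubEightX, ← PowerSeries.coeff_zero_eq_constantCoeff_apply]

/-! A Dyck path is encoded by the heights reached by its up-steps: a sequence with `f 0 = 0` and `1
≤ f (i + 1) ≤ f i + 1`. A move raises by one a block of consecutive heights that starts a run and is
followed by a height not above its first (or by the end of the path). In these terms the order
becomes the local condition `HeightLE` (`DyckPath.below_iff_heightLE`): besides `f ≤ g`, a lower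
path that is strictly below somewhere in a run of the upper path cannot be higher where the next run
starts.

Reading both sequences from left to right, a finite record `(ℓ, r, t)` suffices to check this
condition: the two current heights and a bound for the lower path at the start of a new upper run.
So intervals correspond to walks in a generating tree (`pairWord_mem_words`). Three families of
refined series (diagonal states, off-diagonal states, states with large bound) satisfy linear
recursions in the semilength. These determine the coefficients, and shifting the bound multiplies
the series by a fixed factor, so any solution of the finite system `IsSolution` yields all of them
(`IsSolution.stateSum_eq`).

The system has the catalytic variable `y`. It is solved by the kernel method, but only the result is
verified: with `t = I(x,1)` a root of `x (1 + t)² = t (1 - t)` and `c` the Catalan series in `xy`,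
`I` is rational in `t` and `c` (`exists_isSolution`). The quadratic for `t` has discriminant `1 -
8x`.

Finally, an upper path that returns to the axis must continue with the state `(1, 1, 1)`, which is
also the first state of every interval. Cutting at the last return gives `I = J (1 + I(x,1))`, and
`1 + I(x,1)` is the stated factor. -/

/-! ### Paths encoded by the heights of their up-steps -/

/-- The heights reached after the successive up-steps of a path that starts at height `h`. -/
def upHeights : ℕ → List DyckStep → List ℕ
  | _, [] => []
  | h, .U :: l => (h + 1) :: upHeights (h + 1) l
  | h, .D :: l => upHeights (h - 1) l

/-- The final height of a path that starts at height `h`. -/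
def endHeight : ℕ → List DyckStep → ℕ
  | h, [] => h
  | h, .U :: l => endHeight (h + 1) l
  | h, .D :: l => endHeight (h - 1) l

/-- The path that starts at height `h` never goes below the axis, and ends on it. -/
def Descends : ℕ → List DyckStep → Prop
  | h, [] => h = 0
  | h, .U :: l => Descends (h + 1) l
  | h, .D :: l => 1 ≤ h ∧ Descends (h - 1) l

/-- The path from height `h` to the axis whose up-steps reach the given heights. -/
def ofHeights : ℕ → List ℕ → List DyckStep
  | h, [] => List.replicate h .D
  | h, r :: rs => List.replicate (h + 1 - r) .D ++ .U :: ofHeights r rs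

/-- The list consists of the heights reached by the up-steps of a path from height `h`. -/
def Admissible : ℕ → List ℕ → Prop
  | _, [] => True
  | h, r :: rs => 1 ≤ r ∧ r ≤ h + 1 ∧ Admissible r rs

theorem descends_iff (l : List DyckStep) : ∀ h : ℕ, Descends h l ↔
    l.count .D = l.count .U + h ∧ ∀ i, (l.take i).count .D ≤ (l.take i).count .U + h := by
  induction l with
  | nil => intro h; simp [Descends, eq_comm]
  | cons s l ih =>
    intro h
    have hsplit : ∀ p : ℕ → Prop, (∀ i, p i) ↔ p 0 ∧ ∀ i, p (i + 1) := fun p =>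
      ⟨fun H => ⟨H 0, fun i => H _⟩, fun H i => by cases i with
        | zero => exact H.1
        | succ i => exact H.2 i⟩
    rw [hsplit]
    cases s with
    | U =>
      simp only [Descends, ih, List.take_zero, List.take_succ_cons, List.count_nil]
      simp only [List.count_cons_self, List.count_cons_of_ne (show DyckStep.U ≠ .D by decide)]
      constructor
      · rintro ⟨h1, h2⟩
        exact ⟨by omega, by omega, fun i => by have := h2 i; omega⟩
      · rintro ⟨h1, -, h2⟩
        exact ⟨by omega, fun i => by have := h2 i; omega⟩
    | D =>
      simp only [Descends, ih, List.take_zero, List.take_succ_cons, List.count_nil]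
      simp only [List.count_cons_self, List.count_cons_of_ne (show DyckStep.D ≠ .U by decide)]
      constructor
      · rintro ⟨h0, h1, h2⟩
        exact ⟨by omega, by omega, fun i => by have := h2 i; omega⟩
      · rintro ⟨h1, -, h2⟩
        have := h2 0
        simp only [List.take_zero, List.count_nil] at this
        exact ⟨by omega, by omega, fun i => by have := h2 i; omega⟩

theorem Admissible.mono {h h' : ℕ} (hh : h ≤ h') {rs : List ℕ} (H : Admissible h rs) :
    Admissible h' rs := by
  cases rs with
  | nil => trivial
  | cons r rs => exact ⟨H.1, by have := H.2.1; omega, H.2.2⟩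

theorem admissible_upHeights {l : List DyckStep} : ∀ {h : ℕ}, Descends h l →
    Admissible h (upHeights h l) := by
  induction l with
  | nil => intros; trivial
  | cons s l ih =>
    intro h H
    cases s with
    | U => exact ⟨by omega, le_rfl, ih H⟩
    | D => exact (ih H.2).mono (by omega)

theorem ofHeights_succ {h : ℕ} {rs : List ℕ} (H : Admissible h rs) :
    ofHeights (h + 1) rs = .D :: ofHeights h rs := by
  cases rs with
  | nil => simp [ofHeights, List.replicate_succ]
  | cons r rs =>
    have : h + 1 + 1 - r = (h + 1 - r) + 1 := by have := H.2.1; omega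
    simp [ofHeights, this, List.replicate_succ]

theorem ofHeights_upHeights {l : List DyckStep} : ∀ {h : ℕ}, Descends h l →
    ofHeights h (upHeights h l) = l := by
  induction l with
  | nil => intro h H; obtain rfl : h = 0 := H; rfl
  | cons s l ih =>
    intro h H
    cases s with
    | U => simp [upHeights, ofHeights, ih H]
    | D =>
      obtain ⟨h, rfl⟩ : ∃ k, h = k + 1 := ⟨h - 1, by have := H.1; omega⟩
      have H2 : Descends h l := H.2
      simp only [upHeights, Nat.add_sub_cancel]
      rw [ofHeights_succ (admissible_upHeights H2), ih H2]

theorem upHeights_replicate_D (h k : ℕ) (l : List DyckStep) :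
    upHeights h (List.replicate k .D ++ l) = upHeights (h - k) l := by
  induction k generalizing h with
  | zero => simp
  | succ k ih => simp only [List.replicate_succ, List.cons_append, upHeights, ih]; congr 1; omega

theorem descends_replicate_D {h k : ℕ} (hk : k ≤ h) (l : List DyckStep) :
    Descends h (List.replicate k .D ++ l) ↔ Descends (h - k) l := by
  induction k generalizing h with
  | zero => simp
  | succ k ih =>
    simp only [List.replicate_succ, List.cons_append, Descends]
    rw [ih (by omega), Nat.sub_sub, add_comm 1 k]
    exact and_iff_right (by omega)

theorem descends_ofHeights {rs : List ℕ} : ∀ {h : ℕ}, Admissible h rs →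
    Descends h (ofHeights h rs) := by
  induction rs with
  | nil =>
    intro h _
    have := descends_replicate_D (le_refl h) []
    rw [List.append_nil] at this
    exact this.2 (Nat.sub_self h)
  | cons r rs ih =>
    rintro h ⟨h1, h2, h3⟩
    refine (descends_replicate_D (by omega) _).2 ?_
    have : h - (h + 1 - r) + 1 = r := by omega
    simpa only [Descends, this] using ih h3

theorem upHeights_ofHeights {rs : List ℕ} : ∀ {h : ℕ}, Admissible h rs →
    upHeights h (ofHeights h rs) = rs := by
  induction rs with
  | nil =>
    intro h _
    have := upHeights_replicate_D h h []
    rw [List.append_nil] at this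
    exact this
  | cons r rs ih =>
    rintro h ⟨h1, h2, h3⟩
    have : h - (h + 1 - r) + 1 = r := by omega
    simp only [ofHeights, upHeights_replicate_D, upHeights, this, ih h3]

theorem length_upHeights (l : List DyckStep) : ∀ h : ℕ, (upHeights h l).length = l.count .U := by
  induction l with
  | nil => intro h; rfl
  | cons s l ih =>
    intro h
    cases s with
    | U => simp [upHeights, ih]
    | D => simp [upHeights, ih]

theorem upHeights_append (l l' : List DyckStep) : ∀ h : ℕ,
    upHeights h (l ++ l') = upHeights h l ++ upHeights (endHeight h l) l' := by
  induction l with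
  | nil => intro h; rfl
  | cons s l ih => intro h; cases s <;> simp [upHeights, endHeight, ih]

theorem endHeight_append (l l' : List DyckStep) : ∀ h : ℕ,
    endHeight h (l ++ l') = endHeight (endHeight h l) l' := by
  induction l with
  | nil => intro h; rfl
  | cons s l ih => intro h; cases s <;> simp [endHeight, ih]

theorem upHeights_replicate_U (h k : ℕ) :
    upHeights h (List.replicate k .U) = List.range' (h + 1) k := by
  induction k generalizing h with
  | zero => rfl
  | succ k ih => simp [List.replicate_succ, upHeights, ih, List.range'_succ]

theorem upHeights_only_D (h k : ℕ) : upHeights h (List.replicate k .D) = [] := by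
  have := upHeights_replicate_D h k []
  rwa [List.append_nil] at this

theorem endHeight_replicate_U (h k : ℕ) : endHeight h (List.replicate k .U) = h + k := by
  induction k generalizing h with
  | zero => rfl
  | succ k ih => simp only [List.replicate_succ, endHeight, ih]; omega

theorem endHeight_replicate_D (h k : ℕ) : endHeight h (List.replicate k .D) = h - k := by
  induction k generalizing h with
  | zero => rfl
  | succ k ih => simp only [List.replicate_succ, endHeight, ih]; omega

theorem Descends.of_append {l l' : List DyckStep} : ∀ {h : ℕ}, Descends h (l ++ l') →
    Descends (endHeight h l) l' := by
  induction l with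
  | nil => intro h H; exact H
  | cons s l ih =>
    intro h H
    cases s with
    | U => exact ih (h := h + 1) H
    | D => exact ih (h := h - 1) H.2

/-- Only down-steps follow the last up-step. The default `h` covers a path without up-steps. -/
theorem endHeight_le_getLast (l : List DyckStep) : ∀ h : ℕ,
    endHeight h l ≤ (upHeights h l).getLastD h := by
  induction l with
  | nil => intro h; exact le_rfl
  | cons s l ih =>
    intro h
    cases s with
    | U => exact (ih (h + 1)).trans_eq (List.getLastD_cons ..).symm
    | D =>
      refine (ih (h - 1)).trans ?_
      simp only [upHeights]
      cases upHeights (h - 1) l with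
      | nil => exact Nat.sub_le h 1
      | cons a l => simp only [List.getLastD_cons, le_refl]

theorem Admissible.head_le {h r : ℕ} {rs : List ℕ} (H : Admissible h rs) (hr : r ∈ rs.head?) :
    r ≤ h + 1 := by
  cases rs with
  | nil => simp at hr
  | cons a rs => simp at hr; subst hr; exact H.2.1

/-- The part of the path `ofHeights h rs` up to its last up-step. -/
def riseHeights : ℕ → List ℕ → List DyckStep
  | _, [] => []
  | h, r :: rs => List.replicate (h + 1 - r) .D ++ .U :: riseHeights r rs

theorem ofHeights_append (rs rs' : List ℕ) : ∀ h : ℕ,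
    ofHeights h (rs ++ rs') = riseHeights h rs ++ ofHeights (rs.getLastD h) rs' := by
  induction rs with
  | nil => intro h; rfl
  | cons r rs ih =>
    intro h
    rw [List.getLastD_cons]
    simp only [List.cons_append, ofHeights, riseHeights, ih, List.append_assoc]

theorem ofHeights_eq_rise (rs : List ℕ) (h : ℕ) :
    ofHeights h rs = riseHeights h rs ++ List.replicate (rs.getLastD h) .D := by
  have := ofHeights_append rs [] h
  rwa [List.append_nil] at this

theorem ofHeights_range' {h ρ k : ℕ} (hk : 1 ≤ k) (rs : List ℕ) :
    ofHeights h (List.range' ρ k ++ rs) =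
      List.replicate (h + 1 - ρ) .D ++ List.replicate k .U ++ ofHeights (ρ + k - 1) rs := by
  induction k, hk using Nat.le_induction generalizing h ρ with
  | base => simp [List.range'_succ, ofHeights]
  | succ k hk ih =>
    rw [List.range'_succ, List.cons_append, ofHeights, ih]
    have : ρ + 1 + k - 1 = ρ + (k + 1) - 1 := by omega
    simp [List.replicate_succ, this]

theorem ofHeights_add {h k : ℕ} {rs : List ℕ} (H : Admissible h rs) :
    ofHeights (h + k) rs = List.replicate k .D ++ ofHeights h rs := by
  induction k with
  | zero => simp
  | succ k ih =>
    rw [← add_assoc, ofHeights_succ (H.mono (by omega)), ih, List.replicate_succ, List.cons_append]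

theorem takeWhile_reverse_ofHeights {rs : List ℕ} (h : ℕ) (hrs : rs ≠ []) :
    ((ofHeights h rs).reverse.takeWhile (fun s => decide (s = DyckStep.D))).length =
      rs.getLastD h := by
  obtain ⟨l, hl⟩ : ∃ l, riseHeights h rs = l ++ [.U] := by
    induction rs generalizing h with
    | nil => exact absurd rfl hrs
    | cons r rs ih =>
      cases rs with
      | nil => exact ⟨_, rfl⟩
      | cons r' rs =>
        obtain ⟨l, hl⟩ := ih r (by simp)
        exact ⟨List.replicate (h + 1 - r) .D ++ .U :: l, by
          rw [riseHeights, hl]; simp⟩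
  rw [ofHeights_eq_rise, hl]
  rw [List.reverse_append, List.reverse_replicate, List.takeWhile_append_of_pos (by simp)]
  simp

/-- A visit to the axis before the end must be followed by an up-step, which then reaches height
`1`. The start is off the axis because `1 ≤ h`. -/
theorem two_le_upHeights_iff {l : List DyckStep} : ∀ {h : ℕ}, 1 ≤ h → Descends h l →
    ((∀ i < l.length, (l.take i).count DyckStep.D < (l.take i).count DyckStep.U + h) ↔
      ∀ r ∈ upHeights h l, 2 ≤ r) := by
  induction l with
  | nil => intro h _ _; simp [upHeights]
  | cons s l ih =>
    intro h h1 H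
    have hsplit : ∀ p : ℕ → Prop, (∀ i < (s :: l).length, p i) ↔
        p 0 ∧ ∀ i < l.length, p (i + 1) := fun p =>
      ⟨fun H => ⟨H 0 (by simp), fun i hi => H _ (by simpa using hi)⟩, fun H i hi => by cases i with
        | zero => exact H.1
        | succ i => exact H.2 i (by simpa using hi)⟩
    rw [hsplit]
    cases s with
    | U =>
      have := ih (h := h + 1) (by omega) H
      simp only [upHeights, List.forall_mem_cons, ← this, List.take_zero, List.take_succ_cons,
        List.count_nil, List.count_cons_self,
        List.count_cons_of_ne (show DyckStep.U ≠ .D by decide)]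
      refine and_congr ⟨fun _ => by omega, fun _ => by omega⟩ (forall₂_congr fun i hi => ?_)
      omega
    | D =>
      simp only [upHeights, List.take_zero, List.take_succ_cons,
        List.count_nil, List.count_cons_self,
        List.count_cons_of_ne (show DyckStep.D ≠ .U by decide)]
      rcases Nat.lt_or_ge 1 h with h2 | h2
      · rw [← ih (h := h - 1) (by omega) H.2]
        rw [and_iff_right (by omega)]
        refine forall₂_congr fun i hi => ?_
        omega
      · obtain rfl : h = 1 := by omega
        have H2 : Descends 0 l := H.2
        cases l with
        | nil => simp [upHeights]
        | cons s l =>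
          cases s with
          | U =>
            simp only [upHeights]
            constructor
            · intro h
              have := h.2 0 (by simp)
              simp at this
            · intro h
              have := h 1 (by simp)
              omega
          | D => exact absurd H2.1 (by omega)

theorem admissible_iff_getD {rs : List ℕ} : ∀ {h : ℕ}, Admissible h rs ↔
    ∀ i < rs.length, 1 ≤ (h :: rs).getD (i + 1) 0 ∧
      (h :: rs).getD (i + 1) 0 ≤ (h :: rs).getD i 0 + 1 := by
  induction rs with
  | nil => intro h; simp [Admissible]
  | cons r rs ih =>
    intro h
    rw [Admissible, ih]
    constructor
    · rintro ⟨h1, h2, h3⟩ i hi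
      cases i with
      | zero => exact ⟨h1, h2⟩
      | succ i => exact h3 i (by simpa using hi)
    · intro H
      exact ⟨(H 0 (by simp)).1, (H 0 (by simp)).2, fun i hi => H (i + 1) (by simpa using hi)⟩

theorem getD_append_range'_append (C₁ C₂ : List ℕ) (h k a : ℕ) :
    (C₁ ++ List.range' h k ++ C₂).getD a 0 =
      if a < C₁.length then C₁.getD a 0
      else if a < C₁.length + k then h + (a - C₁.length)
      else C₂.getD (a - (C₁.length + k)) 0 := by
  split_ifs with h1 h2
  · rw [List.append_assoc, List.getD_append _ _ _ _ h1]
  · rw [List.append_assoc, List.getD_append_right _ _ _ _ (by omega),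
      List.getD_append _ _ _ _ (by rw [List.length_range']; omega),
      List.getD_eq_getElem _ _ (by rw [List.length_range']; omega)]
    simp
  · rw [List.getD_append_right _ _ _ _ (by rw [List.length_append, List.length_range']; omega),
      List.length_append, List.length_range']

theorem getLastD_eq_getD (l : List ℕ) : ∀ h, l.getLastD h = (h :: l).getD l.length 0 := by
  induction l with
  | nil => intro h; rfl
  | cons a l ih => intro h; rw [List.getLastD_cons, ih]; rfl

/-! ### Elementary moves as raising of blocks of heights -/

/-- The conditions on the heights `f 1, …, f n` after the up-steps of a path with `f 0 = 0`. -/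
def IsHeightSeq (n : ℕ) (f : ℕ → ℕ) : Prop :=
  f 0 = 0 ∧ ∀ i < n, 1 ≤ f (i + 1) ∧ f (i + 1) ≤ f i + 1

/-- The elementary move on sequences of heights: the block of indices in `[s, e)` is raised. -/
def RaisesBlock (n : ℕ) (f f' : ℕ → ℕ) : Prop :=
  ∃ s e, 1 ≤ s ∧ s < e ∧ e ≤ n + 1 ∧ f s ≤ f (s - 1) ∧
    (∀ a, s ≤ a → a < e → f a + s = f s + a) ∧ (e ≤ n → f e ≤ f s) ∧
    ∀ a ≤ n, f' a = if s ≤ a ∧ a < e then f a + 1 else f a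

namespace DyckPath

variable {n : ℕ}

theorem descends (P : DyckPath n) : Descends 0 P.1.toList :=
  (descends_iff _ 0).2 ⟨P.1.count_U_eq_count_D.symm, P.1.count_D_le_count_U⟩

theorem length_heights (P : DyckPath n) : (upHeights 0 P.1.toList).length = n :=
  (length_upHeights _ _).trans P.2

/-- The height after the `i`-th up-step. -/
def ht (P : DyckPath n) (i : ℕ) : ℕ :=
  (0 :: upHeights 0 P.1.toList).getD i 0

theorem isHeightSeq_ht (P : DyckPath n) : IsHeightSeq n P.ht :=
  ⟨rfl, fun i hi => admissible_iff_getD.1 (admissible_upHeights P.descends) i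
    (by rwa [P.length_heights])⟩

theorem heights_ext {l l' : List ℕ} (hl : l.length = n) (hl' : l'.length = n)
    (H : ∀ i ≤ n, (0 :: l).getD i 0 = (0 :: l').getD i 0) : l = l' := by
  refine List.ext_getElem (hl.trans hl'.symm) fun i h1 h2 => ?_
  have := H (i + 1) (by omega)
  rwa [List.getD_cons_succ, List.getD_cons_succ, List.getD_eq_getElem _ _ h1,
    List.getD_eq_getElem _ _ h2] at this

theorem ht_injective {P Q : DyckPath n} (H : ∀ i ≤ n, P.ht i = Q.ht i) : P = Q := by
  have h := heights_ext P.length_heights Q.length_heights H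
  have h2 : P.1.toList = Q.1.toList := by
    rw [← ofHeights_upHeights P.descends, h, ofHeights_upHeights Q.descends]
  exact Subtype.ext (DyckWord.ext h2)

theorem exists_ht {f : ℕ → ℕ} (hf : IsHeightSeq n f) : ∃ P : DyckPath n, ∀ i ≤ n, P.ht i = f i := by
  set rs := (List.range n).map fun i => f (i + 1) with hrs
  have hlen : rs.length = n := by simp [hrs]
  have hget : ∀ i ≤ n, (0 :: rs).getD i 0 = f i := by
    intro i hi
    cases i with
    | zero => exact hf.1.symm
    | succ i =>
      rw [List.getD_cons_succ, List.getD_eq_getElem _ _ (by omega)]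
      simp [hrs]
  have hadm : Admissible 0 rs := by
    rw [admissible_iff_getD]
    intro i hi
    rw [hget _ (by omega), hget _ (by omega)]
    exact hf.2 i (by omega)
  have hd := (descends_iff _ 0).1 (descends_ofHeights hadm)
  have hup := upHeights_ofHeights hadm
  refine ⟨⟨⟨ofHeights 0 rs, hd.1.symm, hd.2⟩, ?_⟩, fun i hi => ?_⟩
  · change (ofHeights 0 rs).count .U = n
    rw [← length_upHeights _ 0, hup, hlen]
  · change (0 :: upHeights 0 (ofHeights 0 rs)).getD i 0 = f i
    rw [hup, hget i hi]

theorem lastDownRun_eq_ht (hn : 1 ≤ n) (P : DyckPath n) : P.lastDownRun = P.ht n := by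
  have hlen := P.length_heights
  have hne : upHeights 0 P.1.toList ≠ [] := by
    intro h
    rw [h] at hlen
    simp at hlen
    omega
  rw [lastDownRun, ht]
  conv_lhs => rw [← ofHeights_upHeights P.descends]
  rw [takeWhile_reverse_ofHeights 0 hne]
  rw [getLastD_eq_getD, hlen]

theorem isPrime_iff_ht (P : DyckPath n) :
    P.IsPrime ↔ 0 < n ∧ ∀ i, 2 ≤ i → i ≤ n → 2 ≤ P.ht i := by
  refine and_congr_right fun hn => ?_
  have hlen := P.length_heights
  have hd := P.descends
  unfold ht
  cases hl : P.1.toList with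
  | nil => rw [hl] at hlen; simp [upHeights] at hlen; omega
  | cons s l =>
    cases s with
    | D => rw [hl] at hd; exact absurd hd.1 (by omega)
    | U =>
      rw [hl] at hd hlen
      have h2 : Descends 1 l := hd
      have key := two_le_upHeights_iff le_rfl h2
      have e1 : (∀ i, 0 < i → i < (DyckStep.U :: l).length →
          ((DyckStep.U :: l).take i).count DyckStep.D <
            ((DyckStep.U :: l).take i).count DyckStep.U) ↔
          ∀ i < l.length, (l.take i).count DyckStep.D < (l.take i).count DyckStep.U + 1 := by
        constructor
        · intro H i hi
          have := H (i + 1) (by omega) (by simpa using hi)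
          rwa [List.take_succ_cons, List.count_cons_self,
            List.count_cons_of_ne (by decide)] at this
        · intro H i h0 hi
          obtain ⟨i, rfl⟩ : ∃ j, i = j + 1 := ⟨i - 1, by omega⟩
          rw [List.take_succ_cons, List.count_cons_self,
            List.count_cons_of_ne (by decide)]
          exact H i (by simpa using hi)
      rw [e1, key]
      simp only [upHeights, List.length_cons, zero_add] at hlen ⊢
      constructor
      · intro H i hi hin
        obtain ⟨i, rfl⟩ : ∃ j, i = j + 2 := ⟨i - 2, by omega⟩
        rw [List.getD_cons_succ, List.getD_cons_succ, List.getD_eq_getElem _ _ (by omega)]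
        exact H _ (List.getElem_mem _)
      · intro H r hr
        obtain ⟨i, hi, rfl⟩ := List.mem_iff_getElem.1 hr
        have := H (i + 2) (by omega) (by omega)
        rwa [List.getD_cons_succ, List.getD_cons_succ, List.getD_eq_getElem _ _ (by omega)] at this

/-- If `A` ends at height `h`, the up-steps of `U^k` reach `h, …, h + k - 1` after the initial `D`
and `h + 1, …, h + k` without it. Both patterns end at height `h - 1`, so the heights in `B` do not
change and the first of them is at most `h`. -/
theorem Move.raisesBlock {P P' : DyckPath n} (H : Move P P') : RaisesBlock n P.ht P'.ht := by
  obtain ⟨k, A, B, hk, hP, hP'⟩ := H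
  have hd := P.descends
  have hlen := P.length_heights
  rw [hP, List.append_assoc] at hd
  have hd1 := hd.of_append
  set h := endHeight 0 A with hh
  have h1 : 1 ≤ h := hd1.1
  have hB : Descends (h - 1) B := by
    have := hd1.of_append
    simpa only [endHeight, endHeight_append, endHeight_replicate_U, endHeight_replicate_D,
      Nat.add_sub_cancel] using this
  have e : upHeights 0 P.1.toList = upHeights 0 A ++ List.range' h k ++ upHeights (h - 1) B := by
    rw [hP]
    simp only [upHeights_append, endHeight_append, upHeights, endHeight, upHeights_replicate_U,
      upHeights_only_D, endHeight_replicate_U, endHeight_replicate_D, Nat.add_sub_cancel,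
      List.append_nil, ← hh]
    rw [Nat.sub_add_cancel h1]
  have e' : upHeights 0 P'.1.toList =
      upHeights 0 A ++ List.range' (h + 1) k ++ upHeights (h - 1) B := by
    rw [hP']
    simp only [upHeights_append, endHeight_append, upHeights, endHeight, upHeights_replicate_U,
      upHeights_only_D, endHeight_replicate_U, endHeight_replicate_D, Nat.add_sub_cancel,
      List.append_nil, ← hh]
  have hlast : h ≤ (0 :: upHeights 0 A).getD (upHeights 0 A).length 0 := by
    rw [← getLastD_eq_getD]
    exact endHeight_le_getLast A 0
  rw [e] at hlen
  simp only [List.length_append, List.length_range'] at hlen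
  have hhead := fun r => (admissible_upHeights hB).head_le (r := r)
  have hget : ∀ a, P.ht a = _ := fun a => by
    rw [ht, e, ← List.cons_append, ← List.cons_append, getD_append_range'_append]
  have hget' : ∀ a, P'.ht a = _ := fun a => by
    rw [ht, e', ← List.cons_append, ← List.cons_append, getD_append_range'_append]
  simp only [List.length_cons] at hget hget'
  set C₁ := upHeights 0 A
  set C₂ := upHeights (h - 1) B
  refine ⟨C₁.length + 1, C₁.length + 1 + k, by omega, by omega, by omega, ?_, ?_, ?_, ?_⟩
  · rw [hget, hget, if_neg (by omega), if_pos (by omega), if_pos (by omega)]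
    simpa using hlast
  · intro a h2 h3
    rw [hget, hget, if_neg (by omega), if_pos (by omega), if_neg (by omega), if_pos (by omega)]
    omega
  · intro hle
    rw [hget, hget, if_neg (by omega), if_neg (by omega), if_neg (by omega), if_pos (by omega)]
    have := hhead (C₂.getD 0 0) (by
      cases hC : C₂ with
      | nil => rw [hC] at hlen; simp at hlen; omega
      | cons a l => simp)
    simp only [Nat.sub_self]
    omega
  · intro a ha
    rw [hget, hget']
    split_ifs <;> omega

/-- The drop before the block provides the `D`. As the next height is at most the first one of the
block, the block is followed by at least as many down-steps as it has up-steps, which provides `U^k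
D^k`. -/
theorem exists_move_of_raisesBlock {P : DyckPath n} {f : ℕ → ℕ} (H : RaisesBlock n P.ht f) :
    ∃ P' : DyckPath n, Move P P' ∧ ∀ i ≤ n, P'.ht i = f i := by
  obtain ⟨s, e, h1, hse, hen, hs, hblock, he, hf⟩ := H
  have hP := P.isHeightSeq_ht
  have hpos : ∀ i, 1 ≤ i → i ≤ n → 1 ≤ P.ht i := fun i hi hin => by
    have := (hP.2 (i - 1) (by omega)).1
    rwa [Nat.sub_add_cancel hi] at this
  have hf' : IsHeightSeq n f := by
    refine ⟨by rw [hf 0 (by omega), if_neg (by omega)]; exact hP.1, fun i hi => ?_⟩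
    have := hP.2 i hi
    rw [hf _ (by omega), hf _ (by omega)]
    refine ⟨by split_ifs <;> omega, ?_⟩
    split_ifs with h2 h3
    · omega
    · have : i + 1 = s := by omega
      subst this
      simp only [Nat.add_sub_cancel] at hs
      omega
    · omega
    · omega
  obtain ⟨P', hP'⟩ := exists_ht hf'
  refine ⟨P', ?_, hP'⟩
  set C₁ := (upHeights 0 P.1.toList).take (s - 1) with hC₁
  set C₂ := (upHeights 0 P.1.toList).drop (e - 1) with hC₂
  have hlen := P.length_heights
  have hl1 : C₁.length = s - 1 := by rw [hC₁, List.length_take, hlen]; omega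
  have hl2 : C₂.length = n + 1 - e := by rw [hC₂, List.length_drop, hlen]; omega
  have hCget : ∀ a, (0 :: C₁).length = s ∧ (a < s → (0 :: C₁).getD a 0 = P.ht a) ∧
      (e ≤ a → C₂.getD (a - e) 0 = P.ht a) := by
    intro a
    refine ⟨by rw [List.length_cons, hl1]; omega, fun ha => ?_, fun ha => ?_⟩
    · cases a with
      | zero => rfl
      | succ a =>
        rw [ht, List.getD_cons_succ, List.getD_cons_succ, List.getD_eq_getElem _ _ (by omega),
          List.getD_eq_getElem _ _ (by omega)]
        simp [hC₁]
    · obtain ⟨b, rfl⟩ : ∃ b, a = (e - 1 + b) + 1 := ⟨a - e, by omega⟩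
      rw [ht, List.getD_cons_succ, hC₂, List.getD_eq_getElem?_getD, List.getElem?_drop,
        List.getD_eq_getElem?_getD]
      congr 2
      congr 1
      omega
  have e1 : upHeights 0 P.1.toList = C₁ ++ List.range' (P.ht s) (e - s) ++ C₂ := by
    refine heights_ext hlen (by simp; omega) fun a ha => ?_
    rw [← List.cons_append, ← List.cons_append, getD_append_range'_append, (hCget 0).1]
    change P.ht a = _
    split_ifs with h2 h3
    · exact ((hCget a).2.1 h2).symm
    · have := hblock a (by omega) (by omega)
      omega
    · rw [← (hCget a).2.2 (by omega)]
      congr 1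
      omega
  have e2 : upHeights 0 P'.1.toList = C₁ ++ List.range' (P.ht s + 1) (e - s) ++ C₂ := by
    refine heights_ext P'.length_heights (by simp; omega) fun a ha => ?_
    rw [← List.cons_append, ← List.cons_append, getD_append_range'_append, (hCget 0).1]
    change P'.ht a = _
    rw [hP' a ha, hf a ha]
    split_ifs with h2 h3 h4 h5 h6
    · omega
    · have := hblock a (by omega) (by omega)
      omega
    · omega
    · exact ((hCget a).2.1 (by omega)).symm
    · omega
    · rw [← (hCget a).2.2 (by omega)]
      congr 1
      omega
  have hlast : P.ht s ≤ C₁.getLastD 0 := by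
    rw [getLastD_eq_getD, hl1, (hCget (s - 1)).2.1 (by omega)]
    exact hs
  have hs1 := hpos s h1 (by omega)
  have hadm : Admissible (P.ht s - 1) C₂ := by
    rw [admissible_iff_getD, hl2]
    intro i hi
    have g : ∀ j, ((P.ht s - 1) :: C₂).getD (j + 1) 0 = P.ht (e + j) := fun j => by
      rw [List.getD_cons_succ, ← (hCget (e + j)).2.2 (by omega)]
      congr 1
      omega
    rw [g]
    refine ⟨hpos _ (by omega) (by omega), ?_⟩
    cases i with
    | zero =>
      simp only [List.getD_cons_zero]
      have := he (by omega)
      simp only [add_zero]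
      omega
    | succ i =>
      rw [g]
      exact (hP.2 (e + i) (by omega)).2
  obtain ⟨k, hk⟩ : ∃ k, e - s = k := ⟨_, rfl⟩
  rw [hk] at e1 e2
  have w1 := ofHeights_upHeights P.descends
  have w2 := ofHeights_upHeights P'.descends
  rw [e1, List.append_assoc, ofHeights_append, ofHeights_range' (by omega)] at w1
  rw [e2, List.append_assoc, ofHeights_append, ofHeights_range' (by omega)] at w2
  -- One fewer down-step than precede the block in `P`: the last one belongs to the pattern that is
  -- moved.
  refine ⟨k, riseHeights 0 C₁ ++ List.replicate (C₁.getLastD 0 - P.ht s) .D,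
    ofHeights (P.ht s - 1) C₂, by omega, ?_, ?_⟩
  · rw [← w1, show P.ht s + k - 1 = P.ht s - 1 + k by omega, ofHeights_add hadm,
      show C₁.getLastD 0 + 1 - P.ht s = (C₁.getLastD 0 - P.ht s) + 1 by omega,
      List.replicate_succ']
    simp only [List.append_assoc, List.cons_append, List.nil_append]
  · rw [← w2, show P.ht s + 1 + k - 1 = P.ht s - 1 + (k + 1) by omega, ofHeights_add hadm,
      show C₁.getLastD 0 + 1 - (P.ht s + 1) = C₁.getLastD 0 - P.ht s by omega,
      List.replicate_succ']
    simp only [List.append_assoc]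

end DyckPath

/-! ### The order in terms of heights -/

/-- The order of the poset in terms of the heights after the up-steps: whenever the upper path
has a run of up-steps that starts no later than the `a`-th and ends just before the `b`-th up-step,
and the paths differ at `a`, the lower path is at `b` not higher than at `a`. -/
def HeightLE (n : ℕ) (f g : ℕ → ℕ) : Prop :=
  (∀ i ≤ n, f i ≤ g i) ∧ ∀ a b, 1 ≤ a → a < b → b ≤ n →
    (∀ c, a < c → c < b → g c = g (c - 1) + 1) → g b ≤ g (b - 1) → f a < g a → f b ≤ f a

theorem run_eq {g : ℕ → ℕ} {a b : ℕ} (h : ∀ c, a < c → c < b → g c = g (c - 1) + 1) :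
    ∀ c, a ≤ c → c < b → g c + a = g a + c := by
  intro c hac
  induction c, hac using Nat.le_induction with
  | base => intro; rfl
  | succ c hc ih =>
    intro hb
    have := ih (by omega)
    have := h (c + 1) (by omega) hb
    rw [Nat.add_sub_cancel] at this
    omega

theorem heightLE_refl (n : ℕ) (f : ℕ → ℕ) : HeightLE n f f :=
  ⟨fun _ _ => le_rfl, fun _ _ _ _ _ _ _ h => absurd h (lt_irrefl _)⟩

/-- Raising the block can only create new conditions at its end `e`, by joining it to the preceding
run or by opening a gap inside it. There they follow from the old conditions or from `f e ≤ g e ≤ g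
s`. -/
theorem HeightLE.raisesBlock {n : ℕ} {f g g' : ℕ → ℕ} (H : HeightLE n f g)
    (hg : RaisesBlock n g g') : HeightLE n f g' := by
  obtain ⟨s, e, h1, hse, hen, hs, hblock, he, hg'⟩ := hg
  have hin : ∀ a, s ≤ a → a < e → g' a = g a + 1 := fun a h2 h3 => by
    rw [hg' a (by omega), if_pos ⟨h2, h3⟩]
  have hout : ∀ a ≤ n, a < s ∨ e ≤ a → g' a = g a := fun a ha h2 => by
    rw [hg' a ha, if_neg (by omega)]
  refine ⟨fun i hi => ?_, fun a b ha hab hbn hrun hdrop hlt => ?_⟩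
  · have := H.1 i hi
    rw [hg' i hi]
    split_ifs <;> omega
  · have hfa := H.1 a (by omega)
    rcases lt_trichotomy b e with hbe | rfl | hbe
    · rcases lt_trichotomy b s with hbs | rfl | hbs
      · refine H.2 a b ha hab hbn (fun c h2 h3 => ?_) ?_ ?_
        · rw [← hout c (by omega) (by omega), ← hout (c - 1) (by omega) (by omega)]
          exact hrun c h2 h3
        · rw [← hout b (by omega) (by omega), ← hout (b - 1) (by omega) (by omega)]
          exact hdrop
        · rwa [← hout a (by omega) (by omega)]
      · refine H.2 a b ha hab hbn (fun c h2 h3 => ?_) hs ?_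
        · rw [← hout c (by omega) (by omega), ← hout (c - 1) (by omega) (by omega)]
          exact hrun c h2 h3
        · rwa [← hout a (by omega) (by omega)]
      · have e1 := hblock b (by omega) hbe
        have e2 := hblock (b - 1) (by omega) (by omega)
        rw [hin b (by omega) (by omega), hin (b - 1) (by omega) (by omega)] at hdrop
        omega
    · have hrun' : ∀ c, s < c → c < b → g c = g (c - 1) + 1 := fun c h2 h3 => by
        have e1 := hblock c (by omega) h3
        have e2 := hblock (c - 1) (by omega) (by omega)
        omega
      have hgb := he hbn
      have hlastb := hblock (b - 1) (by omega) (by omega)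
      have hgab : g b ≤ g (b - 1) := by omega
      have hfb := H.1 b hbn
      -- If `a` lies before the block, the raised block has been joined to the run of `a`. The old
      -- condition at the former drop `s` gives `f s ≤ f a`, and a second comparison goes from `s`
      -- to `b`.
      rcases Nat.lt_or_ge a s with has | has
      · have e0 := hrun s has hse
        rw [hin s le_rfl hse, hout (s - 1) (by omega) (by omega)] at e0
        have hrun2 : ∀ c, a < c → c < s → g c = g (c - 1) + 1 := fun c h2 h3 => by
          rw [← hout c (by omega) (by omega), ← hout (c - 1) (by omega) (by omega)]
          exact hrun c h2 (by omega)
        rw [hout a (by omega) (by omega)] at hlt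
        have e1 := H.2 a s ha has (by omega) hrun2 hs hlt
        have e2 := run_eq hrun2 (s - 1) (by omega) (by omega)
        rcases Nat.lt_or_ge (f s) (g s) with h4 | h4
        · exact (H.2 s b h1 hse hbn hrun' hgab h4).trans e1
        · omega
      · rcases Nat.lt_or_ge (f a) (g a) with h4 | h4
        · exact H.2 a b ha hab hbn (fun c h2 h3 => hrun' c (by omega) h3) hgab h4
        · have := hblock a has hab
          omega
    · rcases Nat.lt_or_ge a e with hae | hae
      · have e1 := hrun e hae hbe
        have e2 := hblock (e - 1) (by omega) (by omega)
        have e3 := he (by omega)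
        rw [hout e (by omega) (by omega), hin (e - 1) (by omega) (by omega)] at e1
        omega
      · refine H.2 a b ha hab hbn (fun c h2 h3 => ?_) ?_ ?_
        · rw [← hout c (by omega) (by omega), ← hout (c - 1) (by omega) (by omega)]
          exact hrun c h2 h3
        · rw [← hout b (by omega) (by omega), ← hout (b - 1) (by omega) (by omega)]
          exact hdrop
        · rwa [← hout a (by omega) (by omega)]

/-- At the first difference `i`, `f` starts a run. The block to raise is the last run of `f` that
starts in `[i, E)`, cut off at the end `E` of the run of `g` through `i`. A gap persists along a run
of `g`, so there is room to raise, and `HeightLE` itself bounds `f E` by the first height of the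
block. -/
theorem HeightLE.exists_raisesBlock {n : ℕ} {f g : ℕ → ℕ} (hf : IsHeightSeq n f)
    (hg : IsHeightSeq n g) (H : HeightLE n f g) (hne : ∃ i ≤ n, f i < g i) :
    ∃ f', RaisesBlock n f f' ∧ HeightLE n f' g := by
  classical
  obtain ⟨i, ⟨hin, hi⟩, hmin⟩ : ∃ i, (i ≤ n ∧ f i < g i) ∧ ∀ j < i, f j = g j := by
    refine ⟨Nat.find hne, Nat.find_spec hne, fun j hj => ?_⟩
    have h1 := Nat.find_min hne hj
    have h2 := (Nat.find_spec hne).1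
    have := H.1 j (by omega)
    by_contra h3
    exact h1 ⟨by omega, by omega⟩
  have hi0 : 1 ≤ i := by
    rcases Nat.eq_zero_or_pos i with rfl | h
    · rw [hg.1] at hi; omega
    · exact h
  have step : ∀ {u : ℕ → ℕ}, IsHeightSeq n u → ∀ j, 1 ≤ j → j ≤ n → u j ≤ u (j - 1) + 1 := by
    intro u hu j h1 h2
    have := (hu.2 (j - 1) (by omega)).2
    rwa [Nat.sub_add_cancel h1] at this
  obtain ⟨E, hiE, hEn, hE, hrun⟩ : ∃ E, i < E ∧ E ≤ n + 1 ∧ (E ≤ n → g E ≤ g (E - 1)) ∧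
      ∀ c, i < c → c < E → g c = g (c - 1) + 1 := by
    have hex : ∃ b, i < b ∧ (b = n + 1 ∨ g b ≤ g (b - 1)) := ⟨n + 1, by omega, Or.inl rfl⟩
    have hle : Nat.find hex ≤ n + 1 := Nat.find_min' hex ⟨by omega, Or.inl rfl⟩
    have hsp := Nat.find_spec hex
    refine ⟨Nat.find hex, hsp.1, hle, fun h => hsp.2.resolve_left (by omega), fun c h1 h2 => ?_⟩
    have h3 := Nat.find_min hex h2
    have h4 := step hg c (by omega) (by omega)
    by_contra h5
    exact h3 ⟨h1, Or.inr (by omega)⟩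
  obtain ⟨s, his, hsE, hs, hblock⟩ : ∃ s, i ≤ s ∧ s < E ∧ f s ≤ f (s - 1) ∧
      ∀ c, s < c → c < E → f c = f (c - 1) + 1 := by
    have hPi : f i ≤ f (i - 1) := by
      have h1 := step hg i hi0 hin
      have h2 := hmin (i - 1) (by omega)
      omega
    have hle : i ≤ E - 1 := by omega
    refine ⟨Nat.findGreatest (fun s => f s ≤ f (s - 1)) (E - 1),
      Nat.le_findGreatest hle hPi, ?_,
      Nat.findGreatest_spec (P := fun s => f s ≤ f (s - 1)) hle hPi, fun c h1 h2 => ?_⟩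
    · have := Nat.findGreatest_le (P := fun s => f s ≤ f (s - 1)) (E - 1)
      omega
    · have h3 := Nat.findGreatest_is_greatest h1 (by omega)
      have h4 := step hf c (by omega) (by omega)
      omega
  have hlt : ∀ a, i ≤ a → a < E → f a < g a := by
    intro a hia
    induction a, hia using Nat.le_induction with
    | base => intro; exact hi
    | succ a ha ih =>
      intro hE'
      have h1 := ih (by omega)
      have h2 := hrun (a + 1) (by omega) hE'
      have h3 := step hf (a + 1) (by omega) (by omega)
      rw [Nat.add_sub_cancel] at h2 h3
      omega
  refine ⟨fun a => if s ≤ a ∧ a < E then f a + 1 else f a,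
    ⟨s, E, by omega, hsE, hEn, hs, fun a h1 h2 => run_eq hblock a h1 h2, fun h => ?_,
      fun _ _ => rfl⟩, fun a ha => ?_, fun a b ha hab hbn hrun' hdrop hab' => ?_⟩
  · exact H.2 s E (by omega) hsE h (fun c h1 h2 => hrun c (by omega) h2) (hE h)
      (hlt s his hsE)
  · have := H.1 a ha
    dsimp only
    split_ifs with h
    · exact hlt a (by omega) h.2
    · exact this
  · have hfa : f a < g a := by
      dsimp only at hab'
      split_ifs at hab' <;> omega
    have key := H.2 a b ha hab hbn hrun' hdrop hfa
    -- Within the block `g` drops at most at `i`, and before `i` the two paths agree. So the height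
    -- at `b` is not raised and the old inequality survives.
    have hb : ¬ (s ≤ b ∧ b < E) := by
      rintro ⟨h1, h2⟩
      rcases Nat.lt_or_ge i b with h3 | h3
      · have := hrun b h3 h2
        omega
      · have := hmin a (by omega)
        omega
    dsimp only
    rw [if_neg hb]
    split_ifs <;> omega

theorem RaisesBlock.le_and_exists_lt {n : ℕ} {f f' : ℕ → ℕ} (H : RaisesBlock n f f') :
    (∀ i ≤ n, f i ≤ f' i) ∧ ∃ i ≤ n, f i < f' i := by
  obtain ⟨s, e, h1, hse, hen, -, -, -, hf⟩ := H
  refine ⟨fun i hi => ?_, s, by omega, ?_⟩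
  · rw [hf i hi]
    split_ifs <;> omega
  · rw [hf s (by omega), if_pos ⟨le_rfl, hse⟩]
    omega

namespace DyckPath

/-- Moves preserve the condition when applied to the upper path. Conversely, a lower path different
from `Q` can be moved up without losing the condition, and the total difference of heights
decreases. -/
theorem below_iff_heightLE {n : ℕ} (P Q : DyckPath n) : P.Below Q ↔ HeightLE n P.ht Q.ht := by
  constructor
  · intro h
    induction h with
    | refl => exact heightLE_refl _ _
    | tail _ hm ih => exact ih.raisesBlock hm.raisesBlock
  · obtain ⟨d, hd⟩ : ∃ d, ∑ i ∈ Finset.range (n + 1), (Q.ht i - P.ht i) = d := ⟨_, rfl⟩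
    induction d using Nat.strong_induction_on generalizing P with
    | _ d ih =>
      intro H
      by_cases hne : ∃ i ≤ n, P.ht i < Q.ht i
      · obtain ⟨f', hb, hle⟩ := H.exists_raisesBlock P.isHeightSeq_ht Q.isHeightSeq_ht hne
        obtain ⟨P', hm, hP'⟩ := exists_move_of_raisesBlock hb
        have hle' : HeightLE n P'.ht Q.ht := by
          refine ⟨fun i hi => by rw [hP' i hi]; exact hle.1 i hi,
            fun a b ha hab hbn hr hdr hlt => ?_⟩
          rw [hP' a (by omega)] at hlt ⊢
          rw [hP' b hbn]
          exact hle.2 a b ha hab hbn hr hdr hlt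
        refine Relation.ReflTransGen.head hm (ih _ ?_ P' rfl hle')
        rw [← hd]
        obtain ⟨h1, i, hi, h2⟩ := hb.le_and_exists_lt
        refine Finset.sum_lt_sum (fun j hj => ?_) ⟨i, by simpa [Nat.lt_succ_iff] using hi, ?_⟩
        · have hj : j ≤ n := by simpa [Nat.lt_succ_iff] using hj
          have := h1 j hj
          rw [hP' j hj]
          omega
        · have := hle.1 i hi
          rw [hP' i hi]
          omega
      · have : P = Q := ht_injective fun i hi => by
          have := H.1 i hi
          by_contra h
          exact hne ⟨i, hi, by omega⟩
        rw [this]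
        exact Relation.ReflTransGen.refl

end DyckPath

/-! ### Intervals as words read by a state machine -/

/-- The state of a word describing an interval: the final heights `ℓ`, `r` of the upper and lower
path, and the bound `t` on the next height of the lower path if the upper path starts a new run. -/
def nextState (s : ℕ × ℕ × ℕ) (c : ℕ × ℕ) : ℕ × ℕ × ℕ :=
  (c.1, c.2, if c.2 = c.1 then c.1 else min s.2.2 c.2)

/-- The pairs of heights with which a word in the given state can be continued. -/
def allowed (s : ℕ × ℕ × ℕ) : Finset (ℕ × ℕ) :=
  (Finset.Icc 1 (s.1 + 1) ×ˢ Finset.Icc 1 (s.2.1 + 1)).filter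
    fun c => c.2 ≤ c.1 ∧ (c.1 = s.1 + 1 ∨ c.2 ≤ s.2.2)

theorem mem_allowed {s : ℕ × ℕ × ℕ} {c : ℕ × ℕ} : c ∈ allowed s ↔
    (1 ≤ c.1 ∧ c.1 ≤ s.1 + 1) ∧ (1 ≤ c.2 ∧ c.2 ≤ s.2.1 + 1) ∧
      c.2 ≤ c.1 ∧ (c.1 = s.1 + 1 ∨ c.2 ≤ s.2.2) := by
  simp [allowed, and_assoc]

/-- The state of a word, the last letter of which is the head of the list. -/
def stateOf : List (ℕ × ℕ) → ℕ × ℕ × ℕ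
  | [] => (0, 0, 0)
  | c :: w => nextState (stateOf w) c

/-- The words of length `n` that describe intervals. -/
def words : ℕ → Finset (List (ℕ × ℕ))
  | 0 => {[]}
  | n + 1 => (words n).biUnion fun w => (allowed (stateOf w)).image (· :: w)

theorem mem_words_succ {n : ℕ} {c : ℕ × ℕ} {w : List (ℕ × ℕ)} :
    c :: w ∈ words (n + 1) ↔ w ∈ words n ∧ c ∈ allowed (stateOf w) := by
  simp only [words, Finset.mem_biUnion, Finset.mem_image, List.cons.injEq]
  constructor
  · rintro ⟨w', h1, c', h2, rfl, rfl⟩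
    exact ⟨h1, h2⟩
  · rintro ⟨h1, h2⟩
    exact ⟨w, h1, c, h2, rfl, rfl⟩

theorem length_of_mem_words {n : ℕ} {w : List (ℕ × ℕ)} (h : w ∈ words n) : w.length = n := by
  induction n generalizing w with
  | zero => simp [words] at h; simp [h]
  | succ n ih =>
    cases w with
    | nil => simp [words] at h
    | cons c w => simp [ih (mem_words_succ.1 h).1]

theorem sum_words_succ {M : Type*} [AddCommMonoid M] (n : ℕ) (F : List (ℕ × ℕ) → M) :
    ∑ w ∈ words (n + 1), F w = ∑ w ∈ words n, ∑ c ∈ allowed (stateOf w), F (c :: w) := by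
  rw [words, Finset.sum_biUnion]
  · refine Finset.sum_congr rfl fun w _ => Finset.sum_image fun c _ c' _ h => ?_
    exact (List.cons.inj h).1
  · intro w _ w' _ hne
    simp only [Function.onFun, Finset.disjoint_left, Finset.mem_image]
    rintro _ ⟨c, -, rfl⟩ ⟨c', -, h⟩
    exact hne (List.cons.inj h).2.symm

/-- The word that records the two sequences of heights. -/
def pairWord (f g : ℕ → ℕ) : ℕ → List (ℕ × ℕ)
  | 0 => []
  | n + 1 => (g (n + 1), f (n + 1)) :: pairWord f g n

theorem pairWord_eq_iff {f g f' g' : ℕ → ℕ} {n : ℕ} :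
    pairWord f g n = pairWord f' g' n ↔ ∀ i, 1 ≤ i → i ≤ n → f i = f' i ∧ g i = g' i := by
  induction n with
  | zero => simp only [pairWord, true_iff]; intro i h1 h2; omega
  | succ n ih =>
    simp only [pairWord, List.cons.injEq, ih, Prod.mk.injEq]
    constructor
    · rintro ⟨⟨h1, h2⟩, h3⟩ i hi hin
      rcases Nat.lt_or_ge n i with h | h
      · obtain rfl : i = n + 1 := by omega
        exact ⟨h2, h1⟩
      · exact h3 i hi h
    · intro H
      exact ⟨⟨(H (n + 1) (by omega) le_rfl).2, (H (n + 1) (by omega) le_rfl).1⟩,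
        fun i h1 h2 => H i h1 (by omega)⟩

theorem exists_pairWord (w : List (ℕ × ℕ)) : ∃ f g : ℕ → ℕ, f 0 = 0 ∧ g 0 = 0 ∧
    pairWord f g w.length = w := by
  induction w with
  | nil => exact ⟨0, 0, rfl, rfl, rfl⟩
  | cons c w ih =>
    obtain ⟨f, g, hf, hg, h⟩ := ih
    refine ⟨fun i => if i = w.length + 1 then c.2 else f i,
      fun i => if i = w.length + 1 then c.1 else g i, by simpa using hf, by simpa using hg, ?_⟩
    simp only [List.length_cons, pairWord, if_true, List.cons.injEq, true_and]
    refine Eq.trans ?_ h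
    rw [pairWord_eq_iff]
    intro i h1 h2
    rw [if_neg (by omega), if_neg (by omega)]
    exact ⟨rfl, rfl⟩

theorem stateOf_pairWord_fst {f g : ℕ → ℕ} (hg : g 0 = 0) (n : ℕ) :
    (stateOf (pairWord f g n)).1 = g n := by
  cases n with
  | zero => exact hg.symm
  | succ n => rfl

theorem stateOf_pairWord_snd {f g : ℕ → ℕ} (hf : f 0 = 0) (n : ℕ) :
    (stateOf (pairWord f g n)).2.1 = f n := by
  cases n with
  | zero => exact hf.symm
  | succ n => rfl

theorem isHeightSeq_succ {n : ℕ} {f : ℕ → ℕ} : IsHeightSeq (n + 1) f ↔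
    IsHeightSeq n f ∧ 1 ≤ f (n + 1) ∧ f (n + 1) ≤ f n + 1 := by
  constructor
  · intro h
    exact ⟨⟨h.1, fun i hi => h.2 i (by omega)⟩, h.2 n (by omega)⟩
  · rintro ⟨h1, h2⟩
    refine ⟨h1.1, fun i hi => ?_⟩
    rcases Nat.lt_or_ge i n with h | h
    · exact h1.2 i h
    · obtain rfl : i = n := by omega
      exact h2

theorem heightLE_succ {n : ℕ} {f g : ℕ → ℕ} : HeightLE (n + 1) f g ↔ HeightLE n f g ∧
    f (n + 1) ≤ g (n + 1) ∧ (g (n + 1) ≤ g n → ∀ a, 1 ≤ a → a ≤ n →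
      (∀ c, a < c → c ≤ n → g c = g (c - 1) + 1) → f a < g a → f (n + 1) ≤ f a) := by
  constructor
  · intro H
    refine ⟨⟨fun i hi => H.1 i (by omega), fun a b ha hab hb => H.2 a b ha hab (by omega)⟩,
      H.1 _ le_rfl, fun hd a ha han hr hlt => ?_⟩
    exact H.2 a (n + 1) ha (by omega) le_rfl (fun c h1 h2 => hr c h1 (by omega)) hd hlt
  · rintro ⟨H, h1, h2⟩
    refine ⟨fun i hi => ?_, fun a b ha hab hb hr hd hlt => ?_⟩
    · rcases Nat.lt_or_ge n i with h | h
      · obtain rfl : i = n + 1 := by omega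
        exact h1
      · exact H.1 i h
    · rcases Nat.lt_or_ge n b with h | h
      · obtain rfl : b = n + 1 := by omega
        exact h2 hd a ha (by omega) (fun c h3 h4 => hr c h3 (by omega)) hlt
      · exact H.2 a b ha hab h hr hd hlt

/-- The third component of the state condenses all constraints from the current run of `g`. If the
final heights agree there are none, and the recorded bound `g n` is harmless since only `m ≤ g n` is
tested. -/
theorem le_bound_iff {n : ℕ} {f g : ℕ → ℕ} (hf : IsHeightSeq n f) (hg : IsHeightSeq n g)
    (H : HeightLE n f g) {m : ℕ} (hm : m ≤ g n) :
    (∀ a, 1 ≤ a → a ≤ n → (∀ c, a < c → c ≤ n → g c = g (c - 1) + 1) → f a < g a → m ≤ f a) ↔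
      m ≤ (stateOf (pairWord f g n)).2.2 := by
  induction n generalizing m with
  | zero =>
    have : m = 0 := by have := hg.1; omega
    subst this
    simp
  | succ n ih =>
    obtain ⟨hf1, hf2⟩ := isHeightSeq_succ.1 hf
    obtain ⟨hg1, hg2⟩ := isHeightSeq_succ.1 hg
    obtain ⟨H1, H2, H3⟩ := heightLE_succ.1 H
    have ih := fun {m} => ih (m := m) hf1 hg1 H1
    have hfgn := H1.1 n le_rfl
    simp only [pairWord, stateOf, nextState]
    split_ifs with heq
    · refine iff_of_true (fun a ha han hr hlt => ?_) hm
      exfalso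
      -- A gap inside a run of `g` cannot close, since `f` rises by at most one per step.
      have key : ∀ c, a ≤ c → c ≤ n + 1 → f c < g c := by
        intro c hc
        induction c, hc using Nat.le_induction with
        | base => intro; exact hlt
        | succ c hc ihc =>
          intro hcn
          have h1 := ihc (by omega)
          have h2 := hr (c + 1) (by omega) hcn
          have h3 := (hf.2 c (by omega)).2
          rw [Nat.add_sub_cancel] at h2
          omega
      have := key (n + 1) han le_rfl
      omega
    · rcases Nat.lt_or_ge (g n) (g (n + 1)) with hup | hdn
      · have hgn : g (n + 1) = g n + 1 := by omega
        constructor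
        · intro h
          have h1 := h (n + 1) (by omega) le_rfl (fun c h1 h2 => by omega) (by omega)
          refine le_min ((ih (by omega)).1 fun a ha han hr hlt => ?_) h1
          refine h a ha (by omega) (fun c h3 h4 => ?_) hlt
          rcases Nat.lt_or_ge n c with h5 | h5
          · obtain rfl : c = n + 1 := by omega
            exact hgn
          · exact hr c h3 h5
        · intro h a ha han hr hlt
          rw [le_min_iff] at h
          rcases Nat.lt_or_ge n a with h5 | h5
          · obtain rfl : a = n + 1 := by omega
            exact h.2
          · exact (ih (by omega)).2 h.1 a ha h5 (fun c h3 h4 => hr c h3 (by omega)) hlt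
      -- A new run of `g` starts here. `f (n + 1)` already obeys the old bound, so the minimum
      -- forgets the past.
      · have h1 := (ih (m := f (n + 1)) (by omega)).1 (H3 hdn)
        rw [min_eq_right h1]
        constructor
        · intro h
          exact h (n + 1) (by omega) le_rfl (fun c h1 h2 => by omega) (by omega)
        · intro h a ha han hr hlt
          rcases Nat.lt_or_ge n a with h5 | h5
          · obtain rfl : a = n + 1 := by omega
            exact h
          · have := hr (n + 1) (by omega) le_rfl
            rw [Nat.add_sub_cancel] at this
            omega

theorem pairWord_mem_words {f g : ℕ → ℕ} (hf : f 0 = 0) (hg : g 0 = 0) (n : ℕ) :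
    pairWord f g n ∈ words n ↔ IsHeightSeq n f ∧ IsHeightSeq n g ∧ HeightLE n f g := by
  induction n with
  | zero =>
    simp only [pairWord, words, Finset.mem_singleton, true_iff]
    refine ⟨⟨hf, fun i hi => by omega⟩, ⟨hg, fun i hi => by omega⟩, fun i hi => ?_,
      fun a b _ _ _ => by omega⟩
    obtain rfl : i = 0 := by omega
    omega
  | succ n ih =>
    rw [pairWord, mem_words_succ, ih, mem_allowed, isHeightSeq_succ, isHeightSeq_succ,
      heightLE_succ, stateOf_pairWord_fst hg, stateOf_pairWord_snd hf]
    dsimp only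
    constructor
    · rintro ⟨⟨h1, h2, h3⟩, h4, h5, h6, h7⟩
      refine ⟨⟨h1, h5⟩, ⟨h2, h4⟩, h3, h6, fun hle => ?_⟩
      exact (le_bound_iff h1 h2 h3 (by omega)).2 (h7.resolve_left (by omega))
    · rintro ⟨⟨h1, h5⟩, ⟨h2, h4⟩, h3, h6, h7⟩
      refine ⟨⟨h1, h2, h3⟩, h4, h5, h6, ?_⟩
      rcases Nat.lt_or_ge (g n) (g (n + 1)) with hup | hdn
      · left; omega
      · right
        exact (le_bound_iff h1 h2 h3 (by omega)).1 (h7 hdn)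

/-- Intervals are counted by words. -/
theorem ncard_intervals_eq {n : ℕ} (p : DyckPath n × DyckPath n → Prop)
    (q : List (ℕ × ℕ) → Prop) [DecidablePred q]
    (hpq : ∀ I : DyckPath n × DyckPath n, p I ↔ q (pairWord I.1.ht I.2.ht n)) :
    {I : DyckPath n × DyckPath n | I.1.Below I.2 ∧ p I}.ncard = ((words n).filter q).card := by
  set φ : DyckPath n × DyckPath n → List (ℕ × ℕ) := fun I => pairWord I.1.ht I.2.ht n with hφ
  have hinj : Function.Injective φ := by
    rintro ⟨P, Q⟩ ⟨P', Q'⟩ h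
    have h := pairWord_eq_iff.1 h
    refine Prod.ext (DyckPath.ht_injective fun i hi => ?_) (DyckPath.ht_injective fun i hi => ?_)
    · rcases Nat.eq_zero_or_pos i with rfl | h0
      · rfl
      · exact (h i h0 hi).1
    · rcases Nat.eq_zero_or_pos i with rfl | h0
      · rfl
      · exact (h i h0 hi).2
  have himg : φ '' {I | I.1.Below I.2 ∧ p I} = ↑((words n).filter q) := by
    ext w
    simp only [Set.mem_image, Set.mem_ofPred_eq, Finset.coe_filter]
    constructor
    · rintro ⟨I, ⟨h1, h2⟩, rfl⟩
      exact ⟨(pairWord_mem_words rfl rfl n).2 ⟨I.1.isHeightSeq_ht, I.2.isHeightSeq_ht,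
        (DyckPath.below_iff_heightLE _ _).1 h1⟩, (hpq I).1 h2⟩
    · rintro ⟨h1, h2⟩
      obtain ⟨f, g, hf, hg, hw⟩ := exists_pairWord w
      rw [length_of_mem_words h1] at hw
      subst hw
      obtain ⟨hf', hg', hle⟩ := (pairWord_mem_words hf hg n).1 h1
      obtain ⟨P, hP⟩ := DyckPath.exists_ht hf'
      obtain ⟨Q, hQ⟩ := DyckPath.exists_ht hg'
      have e : pairWord P.ht Q.ht n = pairWord f g n :=
        pairWord_eq_iff.2 fun i _ hi => ⟨hP i hi, hQ i hi⟩
      refine ⟨(P, Q), ⟨?_, (hpq _).2 (by rwa [← e] at h2)⟩, e⟩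
      rw [← e, pairWord_mem_words rfl rfl] at h1
      exact (DyckPath.below_iff_heightLE _ _).2 h1.2.2
  rw [← Set.ncard_image_of_injective _ hinj, himg, Set.ncard_coe_finset]

/-- The upper path does not return to the axis before its end. -/
def IsPrimeWord : List (ℕ × ℕ) → Prop
  | [] => False
  | [_] => True
  | c :: d :: w => 2 ≤ c.1 ∧ IsPrimeWord (d :: w)

theorem isPrimeWord_pairWord {f g : ℕ → ℕ} {n : ℕ} : IsPrimeWord (pairWord f g n) ↔
    0 < n ∧ ∀ i, 2 ≤ i → i ≤ n → 2 ≤ g i := by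
  induction n with
  | zero => simp [pairWord, IsPrimeWord]
  | succ n ih =>
    cases n with
    | zero =>
      simp only [pairWord, IsPrimeWord, true_iff]
      exact ⟨by omega, fun i h1 h2 => by omega⟩
    | succ n =>
      have e : IsPrimeWord (pairWord f g (n + 1 + 1)) ↔
        2 ≤ g (n + 2) ∧ IsPrimeWord (pairWord f g (n + 1)) := Iff.rfl
      rw [e, ih]
      constructor
      · rintro ⟨h1, -, h2⟩
        refine ⟨by omega, fun i h3 h4 => ?_⟩
        rcases Nat.lt_or_ge (n + 1) i with h | h
        · obtain rfl : i = n + 2 := by omega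
          exact h1
        · exact h2 i h3 h
      · rintro ⟨-, h⟩
        exact ⟨h _ (by omega) le_rfl, by omega, fun i h1 h2 => h i h1 (by omega)⟩

theorem intervalCount_eq_card {n : ℕ} (hn : 1 ≤ n) (k : ℕ) :
    intervalCount n k = ((words n).filter fun w => (stateOf w).1 = k).card := by
  refine ncard_intervals_eq _ _ fun I => ?_
  rw [stateOf_pairWord_fst rfl, DyckPath.lastDownRun_eq_ht hn]

open Classical in
theorem primeIntervalCount_eq_card {n : ℕ} (hn : 1 ≤ n) (k : ℕ) :
    primeIntervalCount n k =
      ((words n).filter fun w => IsPrimeWord w ∧ (stateOf w).1 = k).card := by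
  refine ncard_intervals_eq _ _ fun I => ?_
  rw [stateOf_pairWord_fst rfl, DyckPath.lastDownRun_eq_ht hn, DyckPath.isPrime_iff_ht,
    isPrimeWord_pairWord]

theorem totalIntervalCount_eq_card (n : ℕ) : totalIntervalCount n = (words n).card := by
  have := ncard_intervals_eq (n := n) (fun _ => True) (fun _ => True) fun _ => Iff.rfl
  simp only [and_true, Finset.filter_true] at this
  exact this

/-! ### Refined sums over states and their recursions -/

open Polynomial in
/-- The sum of `F` over the states of all words of length `n`. -/
noncomputable def stateSum (n : ℕ) (F : ℕ × ℕ × ℕ → ℚ[X]) : ℚ[X] :=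
  ∑ w ∈ words n, F (stateOf w)

open Polynomial in
/-- The sum of `F` over the states that follow the given one. -/
noncomputable def nextSum (F : ℕ × ℕ × ℕ → ℚ[X]) (s : ℕ × ℕ × ℕ) : ℚ[X] :=
  ∑ c ∈ allowed s, F (nextState s c)

/-- The states that occur at the end of words of length `n`. -/
def IsState (n : ℕ) (s : ℕ × ℕ × ℕ) : Prop :=
  s.1 ≤ n ∧ s.2.1 ≤ s.1 ∧ s.2.2 ≤ s.2.1 ∧ (s.2.1 = s.1 → s.2.2 = s.1) ∧ (1 ≤ s.2.2 ↔ 1 ≤ n)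

theorem isState_stateOf {n : ℕ} {w : List (ℕ × ℕ)} (hw : w ∈ words n) :
    IsState n (stateOf w) := by
  induction n generalizing w with
  | zero => simp [words] at hw; simp [hw, stateOf, IsState]
  | succ n ih =>
    cases w with
    | nil => simp [words] at hw
    | cons c w =>
      obtain ⟨h1, h2⟩ := mem_words_succ.1 hw
      obtain ⟨h3, h4, h5, h6, h7⟩ := ih h1
      rw [mem_allowed] at h2
      simp only [stateOf, nextState, IsState]
      split_ifs with h
      · omega
      · have : c.2 < c.1 := by omega
        have ht : 1 ≤ (stateOf w).2.2 := by
          by_contra h8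
          have : ¬ 1 ≤ n := fun h => h8 (h7.2 h)
          omega
        refine ⟨by omega, by omega, min_le_right _ _, by omega, ?_⟩
        simp only [le_min_iff]
        omega

theorem stateSum_succ (n : ℕ) (F) : stateSum (n + 1) F = stateSum n (nextSum F) :=
  sum_words_succ n _

theorem stateSum_congr {n : ℕ} {F F'} (h : ∀ s, IsState n s → F s = F' s) :
    stateSum n F = stateSum n F' :=
  Finset.sum_congr rfl fun _ hw => h _ (isState_stateOf hw)

namespace StateCount

open Polynomial

/-- Marks the states with bound at least `m` with their upper height. -/
noncomputable def atLeast (m : ℕ) (s : ℕ × ℕ × ℕ) : ℚ[X] := if m ≤ s.2.2 then X ^ s.1 else 0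

/-- Indicates the diagonal state at height `m`. -/
noncomputable def diag (m : ℕ) (s : ℕ × ℕ × ℕ) : ℚ[X] := if s = (m, m, m) then 1 else 0

/-- Marks the off-diagonal states with bound `m` and lower height at least `m + j` with their
upper height. -/
noncomputable def off (m j : ℕ) (s : ℕ × ℕ × ℕ) : ℚ[X] :=
  if s.2.2 = m ∧ m + j ≤ s.2.1 ∧ s.2.1 < s.1 then X ^ s.1 else 0

theorem atLeast_eq {n m : ℕ} {s : ℕ × ℕ × ℕ} (hs : IsState n s) :
    atLeast m s = atLeast (m + 1) s + X ^ m * diag m s + off m 0 s := by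
  obtain ⟨l, r, t⟩ := s
  obtain ⟨h1, h2, h3, h4, h5⟩ := hs
  simp only [atLeast, diag, off, Prod.mk.injEq] at *
  rcases lt_trichotomy m t with h | rfl | h
  · rw [if_pos h.le, if_pos (by omega), if_neg (by omega), if_neg (by omega)]; simp
  · rw [if_pos le_rfl, if_neg (by omega)]
    rcases h2.lt_or_eq with h6 | rfl
    · rw [if_neg (by omega), if_pos (by omega)]; simp
    · obtain rfl := h4 rfl
      simp
  · rw [if_neg (by omega), if_neg (by omega), if_neg (by omega), if_neg (by omega)]; simp

/-- The letter `(m + 1, m + 1)` is allowed either because the bound is at least `m + 1`, or as a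
rise from the diagonal state at height `m`. Evaluation at `1` forgets the old upper height. -/
theorem nextSum_diag_succ {n m : ℕ} {s : ℕ × ℕ × ℕ} (hs : IsState n s) :
    nextSum (diag (m + 1)) s = C ((atLeast (m + 1) s).eval 1) + diag m s := by
  have h : ∀ c ∈ allowed s, diag (m + 1) (nextState s c) =
      if (m + 1, m + 1) = c then 1 else 0 := by
    rintro ⟨k, i⟩ -
    simp only [diag, nextState, Prod.mk.injEq]
    refine if_congr ⟨fun h => ⟨h.1.symm, h.2.1.symm⟩, ?_⟩ rfl rfl
    rintro ⟨rfl, rfl⟩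
    simp
  rw [nextSum, Finset.sum_congr rfl h, Finset.sum_ite_eq]
  obtain ⟨l, r, t⟩ := s
  obtain ⟨h1, h2, h3, h4, h5⟩ := hs
  simp only [mem_allowed, atLeast, diag, Prod.mk.injEq] at *
  by_cases h6 : m + 1 ≤ t
  · rw [if_pos (by omega), if_pos h6, if_neg (by omega)]; simp
  · rw [if_neg h6]
    by_cases h7 : m = l ∧ m = r ∧ m = t
    · rw [if_pos (by omega), if_pos (by omega)]; simp
    · rw [if_neg (by omega), if_neg (by omega)]; simp

/-- A new off-diagonal state whose lower height exceeds its bound can only arise by a rise of the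
upper path, which keeps the bound. The difference of the two sums fixes the new lower height at `m +
j + 1`, to be reached from lower height at least `m + j`. -/
theorem nextSum_off_succ {n m j : ℕ} {s : ℕ × ℕ × ℕ} (hs : IsState n s) :
    nextSum (off m (j + 1)) s = nextSum (off m (j + 2)) s + X * off m j s := by
  have h : ∀ c ∈ allowed s, off m (j + 1) (nextState s c) = off m (j + 2) (nextState s c) +
      if (s.1 + 1, m + j + 1) = c then (if s.2.2 = m ∧ m + j < s.1 then X ^ (s.1 + 1) else 0)
        else 0 := by
    rintro ⟨k, i⟩ hc
    rw [mem_allowed] at hc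
    simp only [off, nextState, Prod.mk.injEq] at *
    split_ifs <;> first | omega | simp_all
  rw [nextSum, nextSum, Finset.sum_congr rfl h, Finset.sum_add_distrib, Finset.sum_ite_eq]
  congr 1
  obtain ⟨l, r, t⟩ := s
  obtain ⟨h1, h2, h3, h4, h5⟩ := hs
  simp only [mem_allowed, off, true_or, and_true] at *
  by_cases h6 : t = m ∧ m + j ≤ r ∧ r < l
  · rw [if_pos (by omega), if_pos (by omega), if_pos h6]; ring
  · rw [if_neg h6, mul_zero, ← ite_and, if_neg (by omega)]

/-- New states whose lower height and bound are both `m + 1` arise from a state with bound at least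
`m + 1` by any upper height from `m + 1` to `ℓ + 1`, or from the diagonal state at `m`. The factor
`X - 1` sums the geometric progression. -/
theorem sub_one_mul_nextSum {n m : ℕ} {s : ℕ × ℕ × ℕ} (hs : IsState n s) :
    (X - 1) * (X ^ (m + 1) * nextSum (diag (m + 1)) s + nextSum (off (m + 1) 0) s) =
      (X - 1) * nextSum (off (m + 1) 1) s + X ^ 2 * atLeast (m + 1) s -
        X ^ (m + 1) * C ((atLeast (m + 1) s).eval 1) + (X - 1) * (X ^ (m + 1) * diag m s) := by
  have h : ∀ c ∈ allowed s, X ^ (m + 1) * diag (m + 1) (nextState s c) +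
      off (m + 1) 0 (nextState s c) = off (m + 1) 1 (nextState s c) +
        if c.2 = m + 1 ∧ (nextState s c).2.2 = m + 1 then X ^ c.1 else 0 := by
    rintro ⟨k, i⟩ hc
    rw [mem_allowed] at hc
    simp only [off, diag, nextState, Prod.mk.injEq] at *
    split_ifs <;> first | omega | simp_all
  have h' : X ^ (m + 1) * nextSum (diag (m + 1)) s + nextSum (off (m + 1) 0) s =
      nextSum (off (m + 1) 1) s + ∑ c ∈ (allowed s).filter
        (fun c => c.2 = m + 1 ∧ (nextState s c).2.2 = m + 1), X ^ c.1 := by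
    rw [nextSum, nextSum, nextSum, Finset.mul_sum, ← Finset.sum_add_distrib,
      Finset.sum_congr rfl h, Finset.sum_add_distrib, Finset.sum_filter]
  rw [h', mul_add]
  obtain ⟨l, r, t⟩ := s
  obtain ⟨h1, h2, h3, h4, h5⟩ := hs
  simp only [atLeast, diag, Prod.mk.injEq, nextState] at *
  by_cases h6 : m + 1 ≤ t
  · have e : (allowed (l, r, t)).filter
        (fun c => c.2 = m + 1 ∧ (if c.2 = c.1 then c.1 else min t c.2) = m + 1) =
        (Finset.Ico (m + 1) (l + 2)).image fun k => (k, m + 1) := by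
      ext ⟨k, i⟩
      simp only [Finset.mem_filter, mem_allowed, Finset.mem_image, Finset.mem_Ico, Prod.mk.injEq]
      constructor
      · rintro ⟨h7, rfl, h8⟩
        exact ⟨k, by omega, rfl, rfl⟩
      · rintro ⟨k, h7, rfl, rfl⟩
        refine ⟨by omega, rfl, ?_⟩
        split_ifs <;> omega
    rw [e, Finset.sum_image (by intro a _ b _ h; exact (Prod.mk.inj h).1), if_pos h6,
      if_neg (by omega), mul_comm _ (∑ k ∈ _, _), geom_sum_Ico_mul _ (by omega)]
    simp
    ring
  · rw [if_neg h6]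
    by_cases h7 : m = l ∧ m = r ∧ m = t
    · obtain ⟨rfl, rfl, rfl⟩ := h7
      have e : (allowed (m, m, m)).filter
          (fun c => c.2 = m + 1 ∧ (if c.2 = c.1 then c.1 else min m c.2) = m + 1) =
          {(m + 1, m + 1)} := by
        ext ⟨k, i⟩
        simp only [Finset.mem_filter, mem_allowed, Finset.mem_singleton, Prod.mk.injEq]
        constructor
        · rintro ⟨h7, rfl, h8⟩
          exact ⟨by omega, rfl⟩
        · rintro ⟨rfl, rfl⟩
          simp
      rw [e, Finset.sum_singleton, if_pos ⟨rfl, rfl, rfl⟩]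
      simp
    · have e : (allowed (l, r, t)).filter
          (fun c => c.2 = m + 1 ∧ (if c.2 = c.1 then c.1 else min t c.2) = m + 1) = ∅ := by
        ext ⟨k, i⟩
        simp only [Finset.mem_filter, mem_allowed, Finset.notMem_empty, iff_false]
        rintro ⟨h8, rfl, h9⟩
        split_ifs at h9 <;> omega
      rw [e, Finset.sum_empty, if_neg (by omega)]
      simp

end StateCount

/-- The recursions control only differences in `j` or `m`. Vanishing for large indices then anchors
a downward induction. -/
theorem eq_of_sub_succ_eq {M : Type*} [AddCommGroup M] {u v : ℕ → M} (N : ℕ)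
    (h : ∀ j, u j - u (j + 1) = v j - v (j + 1)) (hu : ∀ j, N ≤ j → u j = 0)
    (hv : ∀ j, N ≤ j → v j = 0) (j : ℕ) : u j = v j := by
  have key : ∀ d j, N ≤ j + d → u j = v j := by
    intro d
    induction d with
    | zero => intro j hj; rw [hu j hj, hv j hj]
    | succ d ih =>
      intro j hj
      have h1 := h j
      rw [ih (j + 1) (by omega)] at h1
      exact sub_left_injective h1
  exact key N j (by omega)

/-! ### Functional equations and uniqueness of their solution -/

namespace StateCount

open Polynomial

/-- The variable `y` as a power series. -/
noncomputable def yVar : PowerSeries ℚ[X] := PowerSeries.C (X : ℚ[X])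

/-- The substitution `y = 1`, as an endomorphism. -/
noncomputable def yOne : PowerSeries ℚ[X] →+* PowerSeries ℚ[X] := constInY.comp setYOne

theorem coeff_yOne (n : ℕ) (f : PowerSeries ℚ[X]) :
    PowerSeries.coeff n (yOne f) = C ((PowerSeries.coeff n f).eval 1) := by
  simp [yOne, constInY, setYOne]

theorem yOne_yVar : yOne yVar = 1 := by
  simp [yOne, constInY, setYOne, yVar]

theorem yOne_X : yOne PowerSeries.X = PowerSeries.X := by
  simp [yOne, constInY, setYOne]

theorem setYOne_constInY (f : PowerSeries ℚ) : setYOne (constInY f) = f := by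
  ext n
  simp [constInY, setYOne]

theorem yOne_yOne (f : PowerSeries ℚ[X]) : yOne (yOne f) = yOne f := by
  simp [yOne, setYOne_constInY]

theorem coeff_yVar_mul (n : ℕ) (f : PowerSeries ℚ[X]) :
    PowerSeries.coeff n (yVar * f) = X * PowerSeries.coeff n f :=
  PowerSeries.coeff_C_mul ..

theorem coeff_yVar_pow_mul (n k : ℕ) (f : PowerSeries ℚ[X]) :
    PowerSeries.coeff n (yVar ^ k * f) = X ^ k * PowerSeries.coeff n f := by
  rw [yVar, ← map_pow]
  exact PowerSeries.coeff_C_mul ..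

/-- The functional equations for the generating function `I` of intervals: `Φ` counts the intervals
whose upper path ends with one down-step, `G` the intervals that end off the diagonal with the
lower path ending with one down-step, and `c` is a Catalan series. -/
structure IsSolution (I Φ G c : PowerSeries ℚ[X]) : Prop where
  eq_I : I = Φ * yVar * (1 + I) + G * c
  eq_G : (yVar - 1) * (Φ * yVar + G) =
    PowerSeries.X * (yVar * (yVar * I - yOne I + (yVar - 1)))
  eq_Φ : Φ = PowerSeries.X * (1 + yOne I)
  eq_c : c = 1 + PowerSeries.X * yVar * c ^ 2

namespace IsSolution

variable {I Φ G c : PowerSeries ℚ[X]}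

theorem yOne_Φ (S : IsSolution I Φ G c) : yOne Φ = Φ := by
  rw [S.eq_Φ, map_mul, map_add, yOne_yOne, yOne_X, map_one]

theorem X_dvd_Φ (S : IsSolution I Φ G c) : PowerSeries.X ∣ Φ := ⟨_, S.eq_Φ⟩

theorem X_dvd_G (S : IsSolution I Φ G c) : PowerSeries.X ∣ G := by
  rw [PowerSeries.X_dvd_iff]
  have h := congrArg PowerSeries.constantCoeff S.eq_G
  have hΦ := PowerSeries.X_dvd_iff.1 S.X_dvd_Φ
  simp only [map_mul, map_add, hΦ, zero_mul, zero_add, PowerSeries.constantCoeff_X] at h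
  refine (mul_eq_zero.1 h).resolve_left ?_
  simp only [yVar, map_sub, PowerSeries.constantCoeff_C, map_one]
  exact X_sub_C_ne_zero (1 : ℚ)

theorem X_dvd_I (S : IsSolution I Φ G c) : PowerSeries.X ∣ I := by
  rw [S.eq_I]
  exact dvd_add (dvd_mul_of_dvd_left (dvd_mul_of_dvd_left S.X_dvd_Φ _) _)
    (dvd_mul_of_dvd_left S.X_dvd_G _)

/-- The three families are geometric: raising the bound by one costs `Φ * yVar`, and raising the
threshold for the lower height by one costs `X * yVar * c`. With this ansatz every recursion reduces
to one equation of `IsSolution`, so induction on `n` identifies the coefficients. -/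
theorem stateSum_eq (S : IsSolution I Φ G c) (n : ℕ) :
    (∀ m, stateSum n (diag m) = PowerSeries.coeff n (Φ ^ m)) ∧
    (∀ m j, stateSum n (off (m + 1) j) = PowerSeries.coeff n
      ((Φ * yVar) ^ m * G * (PowerSeries.X * yVar * c) ^ j * c)) ∧
    ∀ m, stateSum n (atLeast (m + 1)) = PowerSeries.coeff n ((Φ * yVar) ^ m * I) := by
  induction n with
  | zero =>
    have h0 : ∀ F, stateSum 0 F = F (0, 0, 0) := fun F => by simp [stateSum, words, stateOf]
    have hz : ∀ f : PowerSeries ℚ[X], PowerSeries.X ∣ f → PowerSeries.coeff 0 f = 0 :=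
      fun f hf => by
        rw [PowerSeries.coeff_zero_eq_constantCoeff_apply]; exact PowerSeries.X_dvd_iff.1 hf
    refine ⟨fun m => ?_, fun m j => ?_, fun m => ?_⟩
    · rw [h0]
      cases m with
      | zero => simp [diag]
      | succ m =>
        rw [hz _ (dvd_pow S.X_dvd_Φ (by omega))]
        simp [diag]
    · rw [h0, hz _ (dvd_mul_of_dvd_left (dvd_mul_of_dvd_left
        (dvd_mul_of_dvd_right S.X_dvd_G _) _) _)]
      simp [off]
    · rw [h0, hz _ (dvd_mul_of_dvd_right S.X_dvd_I _)]
      simp [atLeast]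
  | succ n ih =>
    obtain ⟨ihD, ihO, ihA⟩ := ih
    have hvanish : ∀ (k : ℕ) (f : PowerSeries ℚ[X]), n + 2 ≤ k → PowerSeries.X ^ k ∣ f →
        PowerSeries.coeff (n + 1) f = 0 := fun k f hk hf =>
      PowerSeries.X_pow_dvd_iff.1 hf _ (by omega)
    have hA1 : ∀ m, stateSum n (fun s => C ((atLeast (m + 1) s).eval 1)) =
        PowerSeries.coeff n (Φ ^ m * yOne I) := fun m => by
      have : PowerSeries.coeff n (Φ ^ m * yOne I) =
          C ((stateSum n (atLeast (m + 1))).eval 1) := by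
        rw [ihA, ← coeff_yOne, map_mul yOne, map_pow yOne, map_mul yOne, S.yOne_Φ, yOne_yVar, mul_one]
      rw [this, stateSum, stateSum, eval_finsetSum, map_sum]
    have hD : ∀ m, stateSum (n + 1) (diag m) = PowerSeries.coeff (n + 1) (Φ ^ m) := by
      intro m
      cases m with
      | zero =>
        rw [stateSum_congr (F' := fun _ => 0)]
        · simp [stateSum, PowerSeries.coeff_one]
        · rintro ⟨l, r, t⟩ ⟨h1, h2, h3, h4, h5⟩
          simp only [diag, Prod.mk.injEq] at *
          rw [if_neg (by omega)]
      | succ m =>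
        rw [stateSum_succ, stateSum_congr (fun s hs => nextSum_diag_succ hs), stateSum,
          Finset.sum_add_distrib]
        have e := hA1 m
        have e' := ihD m
        rw [stateSum] at e e'
        have e2 : Φ ^ (m + 1) = PowerSeries.X * (Φ ^ m * (1 + yOne I)) := by
          linear_combination Φ ^ m * S.eq_Φ
        rw [e, e', e2, PowerSeries.coeff_succ_X_mul, mul_add, mul_one, map_add, add_comm]
    -- This makes the geometric ansatz satisfy the recursion in `j`: with `θ = X * yVar * c` one has
    -- `θ - θ ^ 2 = X * yVar`.
    have hc : c * (1 - PowerSeries.X * yVar * c) = 1 := by linear_combination S.eq_c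
    have hOrec : ∀ m j, stateSum (n + 1) (off (m + 1) (j + 1)) =
        stateSum (n + 1) (off (m + 1) (j + 2)) + X * stateSum n (off (m + 1) j) := by
      intro m j
      rw [stateSum_succ, stateSum_succ, stateSum_congr (fun s hs => nextSum_off_succ hs)]
      simp only [stateSum, Finset.sum_add_distrib, Finset.mul_sum]
    have hOzero : ∀ m, (X - 1) * (X ^ (m + 1) * stateSum (n + 1) (diag (m + 1)) +
        stateSum (n + 1) (off (m + 1) 0)) = (X - 1) * stateSum (n + 1) (off (m + 1) 1) +
        X ^ 2 * stateSum n (atLeast (m + 1)) -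
        X ^ (m + 1) * stateSum n (fun s => C ((atLeast (m + 1) s).eval 1)) +
        (X - 1) * (X ^ (m + 1) * stateSum n (diag m)) := by
      intro m
      simp only [stateSum_succ]
      simp only [stateSum, Finset.mul_sum, ← Finset.sum_add_distrib, ← Finset.sum_sub_distrib]
      refine Finset.sum_congr rfl fun w hw => ?_
      exact sub_one_mul_nextSum (isState_stateOf hw)
    have hO : ∀ m j, stateSum (n + 1) (off (m + 1) j) = PowerSeries.coeff (n + 1)
        ((Φ * yVar) ^ m * G * (PowerSeries.X * yVar * c) ^ j * c) := by
      intro m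
      -- Heights in a word of length `n + 1` are at most `n + 1`, and the `j`-th term is divisible
      -- by the `j`-th power of `X`.
      refine eq_of_sub_succ_eq (n + 2) (fun j => ?_) (fun j hj => ?_) (fun j hj => ?_)
      · rw [← map_sub]
        cases j with
        | zero =>
          have e : (Φ * yVar) ^ m * G * (PowerSeries.X * yVar * c) ^ 0 * c -
              (Φ * yVar) ^ m * G * (PowerSeries.X * yVar * c) ^ (0 + 1) * c =
              (Φ * yVar) ^ m * G := by
            linear_combination ((Φ * yVar) ^ m * G) * hc
          rw [e]
          have h1 := hOzero m
          rw [hD, ihA, hA1, ihD] at h1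
          have h2 : (yVar - 1) * ((Φ * yVar) ^ m * G) +
              (yVar - 1) * (yVar ^ (m + 1) * Φ ^ (m + 1)) = PowerSeries.X *
                (yVar ^ 2 * ((Φ * yVar) ^ m * I) - yVar ^ (m + 1) * (Φ ^ m * yOne I) +
                  (yVar - 1) * (yVar ^ (m + 1) * Φ ^ m)) := by
            rw [mul_pow]
            linear_combination (Φ ^ m * yVar ^ m) * S.eq_G
          have h3 := congrArg (PowerSeries.coeff (n + 1)) h2
          rw [PowerSeries.coeff_succ_X_mul] at h3
          simp only [sub_mul, one_mul, map_add, map_sub, coeff_yVar_mul, coeff_yVar_pow_mul] at h3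
          refine mul_left_cancel₀ (X_sub_C_ne_zero (1 : ℚ)) ?_
          rw [map_one]
          linear_combination h1 - h3
        | succ j =>
          rw [hOrec, ihO, add_sub_cancel_left, ← coeff_yVar_mul, ← PowerSeries.coeff_succ_X_mul]
          congr 1
          linear_combination (-(Φ * yVar) ^ m * G * (PowerSeries.X * yVar * c) ^ (j + 1)) * hc
      · rw [stateSum_congr (F' := fun _ => 0)]
        · simp [stateSum]
        · rintro ⟨l, r, t⟩ ⟨h1, h2, h3, h4, h5⟩
          simp only [off] at *
          rw [if_neg (by omega)]
      · refine hvanish j _ hj (dvd_mul_of_dvd_left (dvd_mul_of_dvd_right ?_ _) _)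
        rw [mul_assoc]
        exact pow_dvd_pow_of_dvd (dvd_mul_right _ _) j
    refine ⟨hD, hO, ?_⟩
    refine eq_of_sub_succ_eq (n + 2) (fun m => ?_) (fun m hm => ?_) (fun m hm => ?_)
    · have h1 : stateSum (n + 1) (atLeast (m + 1)) = stateSum (n + 1) (atLeast (m + 1 + 1)) +
          X ^ (m + 1) * stateSum (n + 1) (diag (m + 1)) + stateSum (n + 1) (off (m + 1) 0) := by
        rw [stateSum_congr (fun s hs => atLeast_eq hs)]
        simp only [stateSum, Finset.sum_add_distrib, Finset.mul_sum]
      rw [h1, hD, hO, ← coeff_yVar_pow_mul, add_assoc, add_sub_cancel_left, ← map_add, ← map_sub]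
      congr 1
      rw [pow_succ (Φ * yVar), mul_pow, pow_zero]
      linear_combination (-Φ ^ m * yVar ^ m) * S.eq_I
    · rw [stateSum_congr (F' := fun _ => 0)]
      · simp [stateSum]
      · rintro ⟨l, r, t⟩ ⟨h1, h2, h3, h4, h5⟩
        simp only [atLeast] at *
        rw [if_neg (by omega)]
    · refine hvanish m _ hm (dvd_mul_of_dvd_left ?_ _)
      exact pow_dvd_pow_of_dvd (dvd_mul_of_dvd_left S.X_dvd_Φ _) m

end IsSolution

end StateCount

/-! ### The explicit solution -/

namespace StateCount

open Polynomial

/-- The generating function of the intervals by semilength, with constant term `0`. -/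
noncomputable def totalSeries : PowerSeries ℚ :=
  (1 - 2 * PowerSeries.X - sqrtOneSubEightX) * (2 * (PowerSeries.X + 1))⁻¹

theorem two_mul_X_add_one_mul_inv :
    (2 * (PowerSeries.X + 1) : PowerSeries ℚ) * (2 * (PowerSeries.X + 1))⁻¹ = 1 := by
  refine PowerSeries.mul_inv_cancel _ ?_
  have h2 : (2 : PowerSeries ℚ) = PowerSeries.C (2 : ℚ) := (map_ofNat PowerSeries.C 2).symm
  simp [h2]

theorem one_add_totalSeries :
    1 + totalSeries = (3 - sqrtOneSubEightX) * (2 * (PowerSeries.X + 1))⁻¹ := by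
  rw [totalSeries]
  linear_combination -two_mul_X_add_one_mul_inv

theorem constantCoeff_totalSeries : PowerSeries.constantCoeff totalSeries = 0 := by
  have h2 : (2 : PowerSeries ℚ) = PowerSeries.C (2 : ℚ) := (map_ofNat PowerSeries.C 2).symm
  rw [totalSeries, map_mul, h2]
  simp [sqrtOneSubEightX_spec.2]

theorem X_mul_one_add_totalSeries_sq :
    PowerSeries.X * (1 + totalSeries) ^ 2 = totalSeries * (1 - totalSeries) := by
  have hT : totalSeries * (2 * (PowerSeries.X + 1)) = 1 - 2 * PowerSeries.X - sqrtOneSubEightX := by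
    rw [totalSeries]
    linear_combination (1 - 2 * PowerSeries.X - sqrtOneSubEightX) * two_mul_X_add_one_mul_inv
  have hs := sqrtOneSubEightX_spec.1
  have h0 : (2 * (PowerSeries.X + 1) : PowerSeries ℚ) ≠ 0 :=
    left_ne_zero_of_mul_eq_one two_mul_X_add_one_mul_inv
  refine mul_left_cancel₀ (pow_ne_zero 2 h0) ?_
  generalize totalSeries = T at *
  generalize sqrtOneSubEightX = s at *
  generalize (PowerSeries.X : PowerSeries ℚ) = x at *
  linear_combination ((x + 1) * (T * (2 * (x + 1)) + 1 - 2 * x - s) + (2 * x - 1) * (2 * (x + 1))) * hT +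
    (1 + x) * hs

/-- The Catalan series in `x y`. -/
noncomputable def catalanXY : PowerSeries ℚ[X] :=
  PowerSeries.mk fun n => (catalan n : ℚ[X]) * X ^ n

theorem catalanXY_eq : catalanXY = 1 + PowerSeries.X * yVar * catalanXY ^ 2 := by
  ext1 n
  cases n with
  | zero => simp [catalanXY]
  | succ n =>
    rw [map_add, mul_assoc, PowerSeries.coeff_succ_X_mul, coeff_yVar_mul, sq,
      PowerSeries.coeff_mul, PowerSeries.coeff_one, if_neg (by omega), zero_add, Finset.mul_sum]
    simp only [catalanXY, PowerSeries.coeff_mk]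
    rw [catalan_succ', Nat.cast_sum, Finset.sum_mul]
    refine Finset.sum_congr rfl fun p hp => ?_
    rw [← Finset.HasAntidiagonal.mem_antidiagonal.1 hp]
    push_cast
    ring

theorem constantCoeff_catalanXY : PowerSeries.constantCoeff catalanXY = 1 := by
  rw [catalanXY_eq]
  simp

/-- Eliminating `Φ` and `G` leaves an equation linear in `I` with coefficients in `x`, `y`, `c` and
`t = I(x,1)`. Express `x` through `t`, and `y` through `t` and `c`. Then the kernel vanishes at `c =
1 + t`, and so does the right side; cancelling `c - 1 - t` gives the fraction below. -/
theorem exists_isSolution : ∃ I Φ G c : PowerSeries ℚ[X], IsSolution I Φ G c ∧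
    yOne I = constInY totalSeries := by
  obtain ⟨c, hc⟩ : ∃ c, c = catalanXY := ⟨_, rfl⟩
  obtain ⟨t, ht⟩ : ∃ t, t = constInY totalSeries := ⟨_, rfl⟩
  have hr1 : c = 1 + PowerSeries.X * yVar * c ^ 2 := by rw [hc]; exact catalanXY_eq
  have hr2 : PowerSeries.X * (1 + t) ^ 2 = t * (1 - t) := by
    have := congrArg constInY X_mul_one_add_totalSeries_sq
    have hX : constInY PowerSeries.X = PowerSeries.X := by simp [constInY]
    simpa only [map_mul, map_pow, map_add, map_sub, map_one, hX, ← ht] using this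
  have hc0 : PowerSeries.constantCoeff c = 1 := by rw [hc]; exact constantCoeff_catalanXY
  have ht0 : PowerSeries.constantCoeff t = 0 := by
    rw [ht, ← PowerSeries.coeff_zero_eq_constantCoeff_apply, constInY, PowerSeries.coeff_map,
      PowerSeries.coeff_zero_eq_constantCoeff_apply, constantCoeff_totalSeries, map_zero]
  have hyt : yOne t = t := by
    rw [ht, yOne, RingHom.comp_apply, setYOne_constInY]
  have hunit : IsUnit ((1 + t) ^ 2 - 2 * (1 + t) * t * c - t * (1 - t) * c ^ 3) := by
    rw [PowerSeries.isUnit_iff_constantCoeff]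
    simp [hc0, ht0]
  obtain ⟨E, hE⟩ := hunit.exists_right_inv
  obtain ⟨I, hI⟩ : ∃ I, I = (c - 1) * (1 + t) * (1 + t - 2 * t * c) * E := ⟨_, rfl⟩
  have hID : I * ((1 + t) ^ 2 - 2 * (1 + t) * t * c - t * (1 - t) * c ^ 3) =
      (c - 1) * (1 + t) * (1 + t - 2 * t * c) := by
    rw [hI]
    linear_combination ((c - 1) * (1 + t) * (1 + t - 2 * t * c)) * hE
  -- The equations contain `yOne I`, so the guess must be self-consistent: at `y = 1` the fraction
  -- has to reduce to `t`.
  have hyI : yOne I = t := by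
    have h1 := congrArg yOne hID
    have h2 := congrArg yOne hE
    have h3 := congrArg yOne hr1
    simp only [map_mul, map_pow, map_add, map_sub, map_one, map_ofNat, hyt, yOne_yVar,
      yOne_X] at h1 h2 h3
    generalize yOne c = d at *
    have key : (yOne I - t) * ((1 + t) ^ 2 - 2 * (1 + t) * t * d - t * (1 - t) * d ^ 3) = 0 := by
      linear_combination h1 + (1 + t - t * d) * ((1 + t) ^ 2 * h3 + d ^ 2 * hr2)
    linear_combination yOne E * key + (t - yOne I) * h2
  -- `G` is read off from `eq_I`, with `1 - X * yVar * c` as the inverse of `c`.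
  refine ⟨I, PowerSeries.X * (1 + t), (I - PowerSeries.X * (1 + t) * yVar * (1 + I)) *
    (1 - PowerSeries.X * yVar * c), c, ⟨?_, ?_, ?_, hr1⟩, hyI.trans ht⟩
  · linear_combination (-(I - PowerSeries.X * (1 + t) * yVar * (1 + I))) * hr1
  · have hcu : IsUnit c := by
      rw [PowerSeries.isUnit_iff_constantCoeff, hc0]
      exact isUnit_one
    refine (hcu.pow 3).mul_left_cancel (hunit.mul_left_cancel ?_)
    rw [hyI]
    generalize (PowerSeries.X : PowerSeries ℚ[X]) = x at *
    generalize yVar = y at *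
    clear hE hunit hI hyI hcu
    linear_combination
      c ^ 2 * (y - 1) * (I - x * (1 + t) * y * (1 + I)) *
        ((1 + t) ^ 2 - 2 * (1 + t) * t * c - t * (1 - t) * c ^ 3) * hr1 +
      c ^ 2 * ((y - 1) * (1 - x * (1 + t) * y) - x * y ^ 2 * c) * hID -
      ((c - 1) * c * (1 + t - t * c) * (1 + t) ^ 2 +
        y * ((1 + t) * ((c - 1) * ((1 + t) ^ 2 - 2 * (1 + t) * t * c - t * (1 - t) * c ^ 3) -
          (c - 1) * (1 + t) * (1 + t - 2 * t * c)) - c * ((c - 1) * (1 + t) * (1 + t - 2 * t * c) +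
          ((1 + t) ^ 2 - 2 * (1 + t) * t * c - t * (1 - t) * c ^ 3))) +
        (1 + t) * (((1 + t) ^ 2 - 2 * (1 + t) * t * c - t * (1 - t) * c ^ 3) +
          (c - 1) * (1 + t) * (1 + t - 2 * t * c))) * hr1 -
      (c - 1) * c * (1 + t - t * c) * y * c ^ 2 * hr2
  · rw [hyI]

end StateCount

/-! ### Decomposition at the last return to the axis -/

namespace StateCount

open Polynomial

theorem sum_monomial_card_filter {α : Type*} (A : Finset α) (h : α → ℕ) (n : ℕ)
    (hh : ∀ a ∈ A, h a ∈ Finset.Icc 1 n) :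
    ∑ k ∈ Finset.Icc 1 n, monomial k ((A.filter fun a => h a = k).card : ℚ) =
      ∑ a ∈ A, (X : ℚ[X]) ^ h a := by
  rw [← Finset.sum_fiberwise_of_maps_to hh]
  refine Finset.sum_congr rfl fun k _ => ?_
  rw [Finset.sum_congr rfl (g := fun _ => (X : ℚ[X]) ^ k)
    fun a ha => by rw [(Finset.mem_filter.1 ha).2]]
  rw [Finset.sum_const, ← C_mul_X_pow_eq_monomial, nsmul_eq_mul, map_natCast]

theorem stateOf_fst_mem_Icc {n : ℕ} (hn : 1 ≤ n) {w : List (ℕ × ℕ)} (hw : w ∈ words n) :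
    (stateOf w).1 ∈ Finset.Icc 1 n := by
  obtain ⟨h1, h2, h3, -, h5⟩ := isState_stateOf hw
  rw [Finset.mem_Icc]
  omega

open Classical in
/-- The sum of `F` over the states of the words of length `n` with prime upper path. -/
noncomputable def primeStateSum (n : ℕ) (F : ℕ × ℕ × ℕ → ℚ[X]) : ℚ[X] :=
  ∑ w ∈ (words n).filter IsPrimeWord, F (stateOf w)

theorem coeff_intervalGF {n : ℕ} (hn : 1 ≤ n) :
    PowerSeries.coeff n intervalGF = stateSum n fun s => X ^ s.1 := by
  rw [intervalGF, PowerSeries.coeff_mk, stateSum,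
    ← sum_monomial_card_filter (words n) (fun w => (stateOf w).1) n
      fun w hw => stateOf_fst_mem_Icc hn hw]
  exact Finset.sum_congr rfl fun k _ => by rw [intervalCount_eq_card hn]

theorem coeff_primeIntervalGF {n : ℕ} (hn : 1 ≤ n) :
    PowerSeries.coeff n primeIntervalGF = primeStateSum n fun s => X ^ s.1 := by
  classical
  rw [primeIntervalGF, PowerSeries.coeff_mk, primeStateSum,
    ← sum_monomial_card_filter _ (fun w => (stateOf w).1) n
      fun w hw => stateOf_fst_mem_Icc hn (Finset.mem_filter.1 hw).1]
  exact Finset.sum_congr rfl fun k _ => by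
    rw [primeIntervalCount_eq_card hn, Finset.filter_filter]

/-- The sum of `F` over the states that follow the given one without a return of the upper path
to the axis. -/
noncomputable def nextPrimeSum (F : ℕ × ℕ × ℕ → ℚ[X]) (s : ℕ × ℕ × ℕ) : ℚ[X] :=
  ∑ c ∈ (allowed s).filter (2 ≤ ·.1), F (nextState s c)

/-- After a return of the upper path the only letter is `(1, 1)`, and the resulting state does not
depend on the past. This is what makes intervals factor. -/
theorem nextSum_eq {n : ℕ} (hn : 1 ≤ n) (F : ℕ × ℕ × ℕ → ℚ[X]) {s : ℕ × ℕ × ℕ}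
    (hs : IsState n s) : nextSum F s = nextPrimeSum F s + F (1, 1, 1) := by
  have e : (allowed s).filter (fun c => ¬ 2 ≤ c.1) = {(1, 1)} := by
    obtain ⟨h1, h2, h3, h4, h5⟩ := hs
    ext ⟨k, i⟩
    simp only [Finset.mem_filter, mem_allowed, Finset.mem_singleton, Prod.mk.injEq]
    omega
  rw [nextSum, nextPrimeSum, ← Finset.sum_filter_add_sum_filter_not _ (fun c => 2 ≤ c.1), e,
    Finset.sum_singleton]
  rfl

theorem primeStateSum_zero (F : ℕ × ℕ × ℕ → ℚ[X]) : primeStateSum 0 F = 0 := by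
  simp [primeStateSum, words, Finset.filter_singleton, IsPrimeWord]

theorem stateSum_one (F : ℕ × ℕ × ℕ → ℚ[X]) : stateSum 1 F = F (1, 1, 1) := by
  have e : allowed (0, 0, 0) = {(1, 1)} := by
    ext ⟨k, i⟩
    simp only [mem_allowed, Finset.mem_singleton, Prod.mk.injEq]
    omega
  rw [stateSum_succ, stateSum, words, Finset.sum_singleton, stateOf, nextSum, e,
    Finset.sum_singleton]
  rfl

theorem primeStateSum_one (F : ℕ × ℕ × ℕ → ℚ[X]) : primeStateSum 1 F = F (1, 1, 1) := by
  classical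
  rw [← stateSum_one F, primeStateSum, stateSum, Finset.filter_true_of_mem]
  intro w hw
  obtain ⟨c, rfl⟩ := List.length_eq_one_iff.1 (length_of_mem_words hw)
  trivial

theorem primeStateSum_succ {n : ℕ} (hn : 1 ≤ n) (F : ℕ × ℕ × ℕ → ℚ[X]) :
    primeStateSum (n + 1) F = primeStateSum n (nextPrimeSum F) := by
  classical
  simp only [primeStateSum, nextPrimeSum, Finset.sum_filter]
  rw [sum_words_succ]
  refine Finset.sum_congr rfl fun w hw => ?_
  cases w with
  | nil => have := length_of_mem_words hw; simp at this; omega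
  | cons d w =>
    by_cases hp : IsPrimeWord (d :: w)
    · rw [if_pos hp]
      refine Finset.sum_congr rfl fun c _ => if_congr ?_ rfl rfl
      exact and_iff_left hp
    · rw [if_neg hp]
      refine Finset.sum_eq_zero fun c _ => if_neg fun h => hp h.2

/-- An interval is split where its upper path last leaves the axis. -/
theorem stateSum_eq_sum_antidiagonal {n : ℕ} (hn : 1 ≤ n) : ∀ F : ℕ × ℕ × ℕ → ℚ[X],
    stateSum n F = ∑ p ∈ Finset.HasAntidiagonal.antidiagonal n,
      ((words p.1).card : ℚ[X]) * primeStateSum p.2 F := by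
  induction n, hn using Nat.le_induction with
  | base =>
    intro F
    rw [stateSum_one, Finset.Nat.sum_antidiagonal_succ']
    simp [primeStateSum_zero, primeStateSum_one, words]
  | succ n hn ih =>
    intro F
    have h1 : stateSum (n + 1) F = stateSum n (nextPrimeSum F) +
        ((words n).card : ℚ[X]) * F (1, 1, 1) := by
      rw [stateSum_succ, stateSum_congr (fun s hs => nextSum_eq hn F hs)]
      simp [stateSum, Finset.sum_add_distrib]
    -- The term at `j = 0` is the prime piece of semilength one; it matches the words of `h1` that
    -- have just returned.
    have h2 : ∀ j, primeStateSum (j + 1) F =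
        primeStateSum j (nextPrimeSum F) + if j = 0 then F (1, 1, 1) else 0 := by
      intro j
      rcases Nat.eq_zero_or_pos j with rfl | hj
      · rw [primeStateSum_zero, primeStateSum_one, if_pos rfl, zero_add]
      · rw [primeStateSum_succ hj, if_neg (by omega), add_zero]
    rw [h1, ih, Finset.Nat.sum_antidiagonal_succ']
    simp only [h2, primeStateSum_zero, mul_zero, zero_add, mul_add,
      Finset.sum_add_distrib]
    congr 1
    rw [Finset.sum_eq_single (n, 0)]
    · simp
    · rintro ⟨i, j⟩ hp hne
      rw [Finset.HasAntidiagonal.mem_antidiagonal] at hp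
      have : j ≠ 0 := by
        rintro rfl
        exact hne (Prod.ext (by simpa using hp) rfl)
      rw [if_neg this, mul_zero]
    · intro h
      exact absurd (Finset.HasAntidiagonal.mem_antidiagonal.2 (by simp)) h

theorem eval_stateSum (n : ℕ) : (stateSum n fun s => X ^ s.1).eval 1 = ((words n).card : ℚ) := by
  simp [stateSum, eval_finsetSum]

/-- For `n ≥ 1` every bound is at least `1`, so the family `atLeast 1` counts all intervals. -/
theorem intervalGF_eq_of_isSolution {I Φ G c : PowerSeries ℚ[X]} (S : IsSolution I Φ G c) :
    intervalGF = I := by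
  ext1 n
  rcases Nat.eq_zero_or_pos n with rfl | hn
  · rw [PowerSeries.coeff_zero_eq_constantCoeff_apply I, PowerSeries.X_dvd_iff.1 S.X_dvd_I]
    simp [intervalGF]
  · rw [coeff_intervalGF hn, stateSum_congr (F' := atLeast (0 + 1)), (S.stateSum_eq n).2.2 0,
      pow_zero, one_mul]
    rintro s ⟨-, -, -, -, h⟩
    rw [atLeast, if_pos (h.2 hn)]

theorem setYOne_intervalGF : setYOne intervalGF = totalSeries := by
  obtain ⟨I, Φ, G, c, S, hI⟩ := exists_isSolution
  rw [intervalGF_eq_of_isSolution S]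
  have := congrArg setYOne hI
  rwa [yOne, RingHom.comp_apply, setYOne_constInY, setYOne_constInY] at this

theorem coeff_setYOne_intervalGF {n : ℕ} (hn : 1 ≤ n) :
    PowerSeries.coeff n (setYOne intervalGF) = ((words n).card : ℚ) := by
  rw [setYOne, PowerSeries.coeff_map, coeff_intervalGF hn, ← eval_stateSum]
  rfl

theorem intervalGF_eq_mul : intervalGF = primeIntervalGF * constInY (1 + totalSeries) := by
  rw [mul_comm]
  ext1 n
  rw [PowerSeries.coeff_mul]
  -- The summand `1` accounts for the empty word, as the part before the last return may be empty.
  have h1 : ∀ i, PowerSeries.coeff i (constInY (1 + totalSeries)) =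
      ((words i).card : ℚ[X]) := by
    intro i
    rw [constInY, PowerSeries.coeff_map, ← setYOne_intervalGF, map_add]
    rcases Nat.eq_zero_or_pos i with rfl | hi
    · rw [setYOne_intervalGF, PowerSeries.coeff_zero_eq_constantCoeff_apply totalSeries,
        constantCoeff_totalSeries]
      simp [words]
    · rw [coeff_setYOne_intervalGF hi, PowerSeries.coeff_one, if_neg (by omega), zero_add,
        map_natCast]
  have h2 : ∀ j, PowerSeries.coeff j primeIntervalGF = primeStateSum j fun s => X ^ s.1 := by
    intro j
    rcases Nat.eq_zero_or_pos j with rfl | hj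
    · rw [primeStateSum_zero]
      simp [primeIntervalGF]
    · exact coeff_primeIntervalGF hj
  simp only [h1, h2]
  rcases Nat.eq_zero_or_pos n with rfl | hn
  · simp [intervalGF, primeStateSum_zero]
  · rw [coeff_intervalGF hn, stateSum_eq_sum_antidiagonal hn]

end StateCount

theorem mainTheorem2 :
    intervalGF =
        primeIntervalGF * constInY ((3 - sqrtOneSubEightX) * (2 * (PowerSeries.X + 1))⁻¹) ∧
      setYOne intervalGF = (1 - 2 * PowerSeries.X - sqrtOneSubEightX) * (2 * (PowerSeries.X + 1))⁻¹ ∧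
      setYOne intervalGF =
        PowerSeries.mk (fun n => if n = 0 then (0 : ℚ) else (totalIntervalCount n : ℚ)) := by
  refine ⟨?_, StateCount.setYOne_intervalGF, ?_⟩
  · rw [← StateCount.one_add_totalSeries]
    exact StateCount.intervalGF_eq_mul
  · ext n
    rw [PowerSeries.coeff_mk]
    split_ifs with h
    · subst h
      rw [StateCount.setYOne_intervalGF, PowerSeries.coeff_zero_eq_constantCoeff_apply,
        StateCount.constantCoeff_totalSeries]
    · rw [StateCount.coeff_setYOne_intervalGF (by omega), totalIntervalCount_eq_card]
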